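/- \textbf{Setting.} All systems are finite dimensional with a fixed computational basis $\{|x\rangle\}$; $|X|$ is the dimension of system $X$; logarithms are base two. A \emph{quantum operation} is a completely positive trace-preserving map. For states $\rho,\sigma$ let $F(\rho,\sigma)=\|\sqrt\rho\sqrt\sigma\|_1$ and $P(\rho,\sigma)=\sqrt{1-F(\rho,\sigma)^2}$. Let $\Psi_X=\frac1{|X|}\sum_{x,x'}|x\rangle\langle x'|$ be the maximally coherent state, $\pi_X=\mathbf 1/|X|$, and $\Delta_X$ the completely dephasing channel. An \emph{incoherent state} is a diagonal one. A \emph{Kraus operator} $K$ is \emph{incoherent} if $K\rho K^\dagger$ is diagonal for every incoherent $\rho$. A \emph{maximally incoherent instrument} is a finite family $(\mathcal E^x)_x$ of completely positive maps, with $\sum_x\mathcal E^x$ trace preserving, such that every $\mathcal E^x$ maps incoherent states to diagonal operators; the output dimension may depend on $x$. A state $\sigma_{AB}$ is \emph{quantum-incoherent} if $\sigma_{AB}=\sum_b p_b\,\sigma^b_A\otimes|b\rangle\langle b|_B$ with a probability distribution $p$ and states $\sigma^b_A$. \textbf{Free operations} $\Lambda_{AB\to A'B'}$. $\mathrm{LQICC}$: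 operations implemented by finitely many rounds, in each of which one party applies a local instrument and announces the outcome, on which the rest of the protocol may depend; Bob's instruments are maximally incoherent and Alice's are arbitrary. $\mathrm{LICC}$: the same, with Alice's instruments also maximally incoherent. $\mathrm{SQI}$: operations $\Lambda(\cdot)=\sum_i(A_i\otimes B_i)(\cdot)(A_i\otimes B_i)^\dagger$ (finite sum) with $\sum_iA_i^\dagger A_i\otimes B_i^\dagger B_i=\mathbf 1$ and all $B_i$ incoherent. $\mathrm{SI}$: the same, with all $A_i$ incoherent too. $\mathrm{QIP}$: operations that map quantum-incoherent states to quantum-incoherent states. \textbf{Assisted distillable coherence.} For a class $\mathcal F$, a state $\rho_{AB}$ and $\varepsilon\in[0,1]$, $$C_{d,\mathcal F}^{\varepsilon}(\rho_{AB})=\max\bigl\{\log|B'| : P\bigl(\operatorname{tr}_{A'}\Lambda_{AB\to A'B'}(\rho_{AB}),\Psi_{B'}\bigr)\le\varepsilon,\ \Lambda\in\mathcal F\bigr\},$$ over all output systems $A'$, $B'$. \textbf{Alternative assisted extractable randomness.} Let $|\psi\rangle_{RAB}$ be a purification of $\rho_{AB}$. Operations $\Lambda_{AB\to C}\in\mathcal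 F$ are those operations in $\mathcal F$ whose output on Alice's side is one-dimensional, $C$ being Bob's output system. For such a $\Lambda$ with a Stinespring isometry $U_{AB\to CE}$ put $\tau[\Lambda]_{CER}=U|\psi\rangle\langle\psi|U^\dagger$, and for a function $f$ from the basis labels of $C$ to those of a system $L$ put $$\tau[\Lambda,\Delta,f]_{LER}=\sum_c|f(c)\rangle\langle f(c)|_L\otimes\langle c|\tau[\Lambda]_{CER}|c\rangle .$$ With $d_{sec}(\tau_{LER}|ER)=\min_{\sigma_{ER}}P(\tau_{LER},\pi_L\otimes\sigma_{ER})$, the minimum being over states of $ER$, let $$\widetilde\ell_{\mathcal F}^{\,\varepsilon}(\rho_{AB})=\max_{\Lambda_{AB\to C}\in\mathcal F}\ \max_f\bigl\{\log|L| : d_{sec}(\tau[\Lambda,\Delta,f]_{LER}|ER)\le\varepsilon\bigr\}.$$ \textbf{Theorem.} Let $\mathcal F\in\{\mathrm{LICC},\mathrm{LQICC},\mathrm{SI},\mathrm{SQI},\mathrm{QIP}\}$, let $\rho_{AB}$ be a bipartite state and $\varepsilon\in[0,1]$. Then, for every choice of the purification of $\rho_{AB}$ and of the Stinespring isometries of the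 operations, $$C_{d,\mathcal F}^{\varepsilon}(\rho_{AB})=\widetilde\ell_{\mathcal F}^{\,\varepsilon}(\rho_{AB}).$$ Here, for $\varepsilon<1$, both maxima exist; in general they are understood as suprema in $[-\infty,\infty]$ (for $\varepsilon=1$ the rates are unbounded). -/

import Mathlib

open scoped Matrix Kronecker ComplexOrder MatrixOrder

namespace AssistedCoherence

/-! ### States, fidelity, purified distance

A system of dimension `d` is represented by the index set `Fin d` of its computational basis and
operators on it are complex matrices. Composite systems are indexed by products. -/

section States

variable {m n : Type*} [Fintype m] [DecidableEq m] [Fintype n] [DecidableEq n]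

/-- Density operators. -/
def IsState (ρ : Matrix m m ℂ) : Prop := ρ.PosSemidef ∧ ρ.trace = 1

/-- The cone of diagonal positive semidefinite operators. -/
def IsIncoherentCone (X : Matrix m m ℂ) : Prop := X.PosSemidef ∧ X.IsDiag

/-- Incoherent states: density operators that are diagonal in the computational basis. -/
def IsIncoherentState (ρ : Matrix m m ℂ) : Prop := IsState ρ ∧ ρ.IsDiag

/-- The rank-one operator `|v⟩⟨v|`. -/
def proj (v : m → ℂ) : Matrix m m ℂ := Matrix.vecMulVec v (star v)

/-- The trace norm `‖M‖₁ = tr √(M† M)`. -/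
noncomputable def traceNorm (M : Matrix m m ℂ) : ℝ := (CFC.sqrt (Mᴴ * M)).trace.re

/-- The generalized fidelity `‖√ρ √σ‖₁ + √((1 - tr ρ)(1 - tr σ))`. -/
noncomputable def fidelity (ρ σ : Matrix m m ℂ) : ℝ :=
  traceNorm (CFC.sqrt ρ * CFC.sqrt σ) + √((1 - ρ.trace.re) * (1 - σ.trace.re))

/-- The purified distance `√(1 - F²)`. -/
noncomputable def purifiedDistance (ρ σ : Matrix m m ℂ) : ℝ := √(1 - fidelity ρ σ ^ 2)

/-- Partial trace over the first tensor factor. -/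
def traceLeft (X : Matrix (m × n) (m × n) ℂ) : Matrix n n ℂ :=
  Matrix.of fun p q => ∑ i, X (i, p) (i, q)

/-- Partial trace over the second tensor factor. -/
def traceRight (X : Matrix (m × n) (m × n) ℂ) : Matrix m m ℂ :=
  Matrix.of fun p q => ∑ i, X (p, i) (q, i)

end States

/-- The maximally coherent state of dimension `d`: the projection on `d^(-1/2) ∑ |i⟩`. -/
noncomputable def maxCoherent (d : ℕ) : Matrix (Fin d) (Fin d) ℂ :=
  proj fun _ => ((1 / √(d : ℝ) : ℝ) : ℂ)

/-- The completely mixed state of dimension `d`. -/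
noncomputable def maxMixed (d : ℕ) : Matrix (Fin d) (Fin d) ℂ := (1 / (d : ℂ)) • 1

/-! ### Quantum operations -/

/-- Linear maps between operator spaces. -/
abbrev Op (m n : Type*) := Matrix m m ℂ →ₗ[ℂ] Matrix n n ℂ

section Operations

variable {m m' : Type*}

/-- `E ⊗ id`. -/
def mapLeft (E : Op m m') (n : Type*) : Op (m × n) (m' × n) where
  toFun X := Matrix.of fun p q => E (Matrix.of fun i j => X (i, p.2) (j, q.2)) p.1 q.1
  map_add' X Y := by
    ext p q
    exact congrFun (congrFun (E.map_add (Matrix.of fun i j => X (i, p.2) (j, q.2))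
      (Matrix.of fun i j => Y (i, p.2) (j, q.2))) p.1) q.1
  map_smul' c X := by
    ext p q
    exact congrFun (congrFun (E.map_smul c (Matrix.of fun i j => X (i, p.2) (j, q.2))) p.1) q.1

/-- `id ⊗ E`. -/
def mapRight (n : Type*) (E : Op m m') : Op (n × m) (n × m') where
  toFun X := Matrix.of fun p q => E (Matrix.of fun i j => X (p.1, i) (q.1, j)) p.2 q.2
  map_add' X Y := by
    ext p q
    exact congrFun (congrFun (E.map_add (Matrix.of fun i j => X (p.1, i) (q.1, j))
      (Matrix.of fun i j => Y (p.1, i) (q.1, j))) p.2) q.2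
  map_smul' c X := by
    ext p q
    exact congrFun (congrFun (E.map_smul c (Matrix.of fun i j => X (p.1, i) (q.1, j))) p.2) q.2

/-- Complete positivity: `id_k ⊗ E` is positive for every `k`. -/
def IsCP (E : Op m m') : Prop :=
  ∀ (k : ℕ) (X : Matrix (Fin k × m) (Fin k × m) ℂ), X.PosSemidef →
    (mapRight (Fin k) E X).PosSemidef

end Operations

/-- Quantum operations: completely positive trace-preserving maps. -/
structure Channel (m n : Type*) [Fintype m] [Fintype n] where
  toOp : Op m n
  cp : IsCP toOp
  tp : ∀ X, (toOp X).trace = X.trace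

/-- A Stinespring isometry `U` (with environment `Fin e`) of a quantum operation `Λ`:
`U† U = 1` and `Λ(X) = tr_E (U X U†)`. -/
structure Stinespring {m n : Type*} [Fintype m] [DecidableEq m] [Fintype n]
    (Λ : Channel m n) where
  e : ℕ
  U : Matrix (n × Fin e) m ℂ
  isometry : Uᴴ * U = 1
  dilates : ∀ X, Λ.toOp X = traceRight (U * X * Uᴴ)

/-! ### Free operations of the distributed resource theory of coherence -/

/-- A Kraus operator is incoherent if it maps incoherent states into the diagonal cone. -/
def IsIncoherentKraus {m n : Type*} [Fintype m] [Fintype n]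
    (K : Matrix n m ℂ) : Prop :=
  ∀ ρ : Matrix m m ℂ, IsIncoherentState ρ → IsIncoherentCone (K * ρ * Kᴴ)

/-- Quantum instruments: finite families of completely positive maps, indexed by the classical
outcome, whose sum is trace preserving. The output dimension may depend on the outcome. -/
def IsInstrument {d k : ℕ} {d' : Fin k → ℕ} (E : ∀ x, Op (Fin d) (Fin (d' x))) : Prop :=
  (∀ x, IsCP (E x)) ∧ ∀ X, ∑ x, (E x X).trace = X.trace

/-- Maximally incoherent instruments: conditioned on every outcome, incoherent states are mapped
to (subnormalized) incoherent states; equivalently, the operation that also records the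
outcome in a classical register is a maximally incoherent operation. With a single outcome, these
are exactly the maximally incoherent operations (MIO). -/
def IsMIOInstrument {d k : ℕ} {d' : Fin k → ℕ} (E : ∀ x, Op (Fin d) (Fin (d' x))) : Prop :=
  IsInstrument E ∧ ∀ ρ, IsIncoherentState ρ → ∀ x, IsIncoherentCone (E x ρ)

/-- Operations `AB → A'B'` on bipartite systems of the given dimensions. -/
abbrev BiOp (a b a' b' : ℕ) := Op (Fin a × Fin b) (Fin a' × Fin b')

/-- Operations implemented by finitely many rounds of local operations and classical
communication, where Bob's local instruments are maximally incoherent, and Alice's are too if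
`aliceIncoherent` holds and are arbitrary otherwise. In each round one party applies a local
instrument and announces the outcome `x`, on which the rest of the protocol may depend. -/
inductive IsLOCC (aliceIncoherent : Prop) (a' b' : ℕ) : (a b : ℕ) → BiOp a b a' b' → Prop
  | done : IsLOCC aliceIncoherent a' b' a' b' LinearMap.id
  | alice {a b k : ℕ} (d : Fin k → ℕ) (E : ∀ x, Op (Fin a) (Fin (d x)))
      (hE : IsInstrument E) (hinc : aliceIncoherent → IsMIOInstrument E)
      (Λ : ∀ x, BiOp (d x) b a' b') (h : ∀ x, IsLOCC aliceIncoherent a' b' (d x) b (Λ x)) :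
      IsLOCC aliceIncoherent a' b' a b (∑ x, Λ x ∘ₗ mapLeft (E x) (Fin b))
  | bob {a b k : ℕ} (d : Fin k → ℕ) (E : ∀ x, Op (Fin b) (Fin (d x)))
      (hE : IsMIOInstrument E)
      (Λ : ∀ x, BiOp a (d x) a' b') (h : ∀ x, IsLOCC aliceIncoherent a' b' a (d x) (Λ x)) :
      IsLOCC aliceIncoherent a' b' a b (∑ x, Λ x ∘ₗ mapRight (Fin a) (E x))

/-- Separable operations `X ↦ ∑ i, (A i ⊗ B i) X (A i ⊗ B i)†` with incoherent Kraus operators on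
Bob's side, and also on Alice's side if `aliceIncoherent` holds. -/
def IsSeparable (aliceIncoherent : Prop) {a b a' b' : ℕ} (Λ : BiOp a b a' b') : Prop :=
  ∃ (k : ℕ) (A : Fin k → Matrix (Fin a') (Fin a) ℂ) (B : Fin k → Matrix (Fin b') (Fin b) ℂ),
    (aliceIncoherent → ∀ i, IsIncoherentKraus (A i)) ∧ (∀ i, IsIncoherentKraus (B i)) ∧
    ∑ i, ((A i)ᴴ * A i) ⊗ₖ ((B i)ᴴ * B i) = 1 ∧
    ∀ X, Λ X = ∑ i, (A i ⊗ₖ B i) * X * (A i ⊗ₖ B i)ᴴ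

/-- Quantum-incoherent states `∑ b, p_b σ^b ⊗ |b⟩⟨b|`. -/
def IsQuantumIncoherent {a b : ℕ} (σ : Matrix (Fin a × Fin b) (Fin a × Fin b) ℂ) : Prop :=
  ∃ (p : Fin b → ℝ) (s : Fin b → Matrix (Fin a) (Fin a) ℂ),
    (∀ i, 0 ≤ p i) ∧ ∑ i, p i = 1 ∧ (∀ i, IsState (s i)) ∧
    σ = ∑ i, (p i : ℂ) • (s i ⊗ₖ Matrix.single i i (1 : ℂ))

/-- Operations preserving the set of quantum-incoherent states. -/
def IsQIPreserving {a b a' b' : ℕ} (Λ : BiOp a b a' b') : Prop :=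
  ∀ σ, IsQuantumIncoherent σ → IsQuantumIncoherent (Λ σ)

/-- Names of the five classes of free bipartite operations. -/
inductive FreeClass
  | LICC | LQICC | SI | SQI | QIP

/-- The free operations `AB → A'B'` of each class. -/
def FreeClass.ops (F : FreeClass) (a b a' b' : ℕ) :
    Set (Channel (Fin a × Fin b) (Fin a' × Fin b')) :=
  match F with
  | .LICC => {Λ | IsLOCC True a' b' a b Λ.toOp}
  | .LQICC => {Λ | IsLOCC False a' b' a b Λ.toOp}
  | .SI => {Λ | IsSeparable True Λ.toOp}
  | .SQI => {Λ | IsSeparable False Λ.toOp}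
  | .QIP => {Λ | IsQIPreserving Λ.toOp}

/-! ### Assisted coherence distillation -/

/-- The achievable rates `log₂ |B'|` of assisted coherence distillation with error `ε`. -/
def distillationRates (F : FreeClass) (ε : ℝ) {a b : ℕ}
    (ρ : Matrix (Fin a × Fin b) (Fin a × Fin b) ℂ) : Set ℝ :=
  {x | ∃ a' b' : ℕ, ∃ Λ ∈ F.ops a b a' b',
    purifiedDistance (traceLeft (Λ.toOp ρ)) (maxCoherent b') ≤ ε ∧ x = Real.logb 2 b'}

/-- The one-shot assisted distillable coherence (`⊤` if the rates are unbounded). -/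
noncomputable def distillableCoherence (F : FreeClass) (ε : ℝ) {a b : ℕ}
    (ρ : Matrix (Fin a × Fin b) (Fin a × Fin b) ℂ) : EReal :=
  sSup ((fun x : ℝ => (x : EReal)) '' distillationRates F ε ρ)

/-! ### Alternative assisted incoherent randomness extraction -/

/-- `ψ` is a purification of `ρ` with reference system `Fin r`. -/
def IsPurification {m : Type*} {r : ℕ} (ψ : Fin r × m → ℂ)
    (ρ : Matrix m m ℂ) : Prop :=
  traceLeft (proj ψ) = ρ

/-- The security measure `min_σ P(τ, π ⊗ σ)`, with `σ` ranging over the states of the second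
system. -/
noncomputable def dSec {l : ℕ} {s : Type*} [Fintype s] [DecidableEq s]
    (τ : Matrix (Fin l × s) (Fin l × s) ℂ) : ℝ :=
  ⨅ σ : {σ : Matrix s s ℂ // IsState σ}, purifiedDistance τ (maxMixed l ⊗ₖ σ.1)

/-- The vector `(U ⊗ 1_R) |ψ⟩` on the system `C(ER)`, for a Stinespring isometry `U` of an
operation `AB → C`, where `C` is in Bob's possession (Alice's output is one-dimensional). -/
def tauVec {a b c r : ℕ} {Λ : Channel (Fin a × Fin b) (Fin 1 × Fin c)} (S : Stinespring Λ)
    (ψ : Fin r × (Fin a × Fin b) → ℂ) : Fin c × (Fin S.e × Fin r) → ℂ :=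
  fun q => ∑ p, S.U ((0, q.1), q.2.1) p * ψ (q.2.2, p)

/-- The completely dephasing channel on the first system. -/
def dephaseLeft {c : ℕ} {s : Type*} (X : Matrix (Fin c × s) (Fin c × s) ℂ) :
    Matrix (Fin c × s) (Fin c × s) ℂ :=
  Matrix.of fun p q => if p.1 = q.1 then X p q else 0

/-- The hash function `f` applied to a classical-quantum state
`∑ x, |x⟩⟨x| ⊗ X_x`, resulting in `∑ x, |f x⟩⟨f x| ⊗ X_x`. -/
def applyHash {c l : ℕ} {s : Type*} (f : Fin c → Fin l) (X : Matrix (Fin c × s) (Fin c × s) ℂ) :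
    Matrix (Fin l × s) (Fin l × s) ℂ :=
  ∑ x, Matrix.single (f x) (f x) (1 : ℂ) ⊗ₖ Matrix.of fun i j => X (x, i) (x, j)

/-- The final state `τ[Λ, Δ, f]` on `L(ER)` of the protocol `(Λ, Δ, f)`. -/
def finalState {a b c r l : ℕ} {Λ : Channel (Fin a × Fin b) (Fin 1 × Fin c)} (S : Stinespring Λ)
    (ψ : Fin r × (Fin a × Fin b) → ℂ) (f : Fin c → Fin l) :
    Matrix (Fin l × (Fin S.e × Fin r)) (Fin l × (Fin S.e × Fin r)) ℂ :=
  applyHash f (dephaseLeft (proj (tauVec S ψ)))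

/-- The achievable rates `log₂ |L|` of alternative assisted incoherent randomness extraction, when
`ψ` is the purification of the source state and `V` the choice of Stinespring isometries. -/
def extractionRates (F : FreeClass) (ε : ℝ) {a b r : ℕ} (ψ : Fin r × (Fin a × Fin b) → ℂ)
    (V : ∀ (c : ℕ) (Λ : Channel (Fin a × Fin b) (Fin 1 × Fin c)), Stinespring Λ) : Set ℝ :=
  {x | ∃ c : ℕ, ∃ Λ ∈ F.ops a b 1 c, ∃ (l : ℕ) (f : Fin c → Fin l),
    dSec (finalState (V c Λ) ψ f) ≤ ε ∧ x = Real.logb 2 l}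

/-- The alternative one-shot assisted extractable randomness (`⊤` if the rates are unbounded). -/
noncomputable def extractableRandomness (F : FreeClass) (ε : ℝ) {a b r : ℕ}
    (ψ : Fin r × (Fin a × Fin b) → ℂ)
    (V : ∀ (c : ℕ) (Λ : Channel (Fin a × Fin b) (Fin 1 × Fin c)), Stinespring Λ) : EReal :=
  sSup ((fun x : ℝ => (x : EReal)) '' extractionRates F ε ψ V)

/-- Every quantum operation has a Stinespring isometry. -/
theorem nonempty_stinespring {m n : Type*} [Fintype m] [DecidableEq m] [Fintype n] [DecidableEq n]
    (Λ : Channel m n) : Nonempty (Stinespring Λ) := by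
  let e : m ≃ Fin (Fintype.card m) := Fintype.equivFin m
  let v : Fin (Fintype.card m) × m → ℂ := fun q => if e q.2 = q.1 then 1 else 0
  have hJ := Λ.cp _ _ (Matrix.posSemidef_vecMulVec_self_star v)
  obtain ⟨D, hD⟩ := CStarAlgebra.nonneg_iff_eq_star_mul_self.mp hJ.nonneg
  rw [Matrix.star_eq_conjTranspose] at hD
  have key : ∀ p q s t, Λ.toOp (Matrix.single p q 1) s t =
      ∑ r, star (D r (e p, s)) * D r (e q, t) := by
    intro p q s t
    have h := congrFun (congrFun hD (e p, s)) (e q, t)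
    rw [Matrix.mul_apply] at h
    refine Eq.trans ?_ h
    have h2 : (Matrix.of fun i j => Matrix.vecMulVec v (star v) (e p, i) (e q, j)) =
        Matrix.single p q (1 : ℂ) := by
      ext i j
      simp only [Matrix.of_apply, Matrix.vecMulVec_apply, v, Pi.star_apply, Matrix.single_apply,
        e.injective.eq_iff]
      by_cases h1 : i = p <;> by_cases h2 : j = q <;> simp [h1, h2] <;> grind
    change _ = Λ.toOp (Matrix.of fun i j => Matrix.vecMulVec v (star v) (e p, i) (e q, j)) s t
    rw [h2]
  let g := Fintype.equivFin (Fin (Fintype.card m) × n)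
  have hX : ∀ X s t, Λ.toOp X s t =
      ∑ p, ∑ q, X p q * ∑ r, star (D r (e p, s)) * D r (e q, t) := by
    intro X s t
    conv_lhs => rw [Matrix.matrix_eq_sum_single X]
    simp only [map_sum, Matrix.sum_apply]
    refine Finset.sum_congr rfl fun p _ => Finset.sum_congr rfl fun q _ => ?_
    rw [← key, ← mul_one (X p q), ← smul_eq_mul (X p q) (1 : ℂ), ← Matrix.smul_single, map_smul]
    simp
  refine ⟨⟨_, Matrix.of fun y p => star (D (g.symm y.2) (e p, y.1)), ?_, ?_⟩⟩
  · ext p q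
    have h := Λ.tp (Matrix.single q p 1)
    rw [Matrix.trace] at h
    simp only [Matrix.diag_apply, key] at h
    rw [Matrix.mul_apply, Fintype.sum_prod_type]
    simp only [Matrix.conjTranspose_apply, Matrix.of_apply, star_star]
    have h3 : ∀ s, ∑ y, D (g.symm y) (e p, s) * star (D (g.symm y) (e q, s)) =
        ∑ r, star (D r (e q, s)) * D r (e p, s) := fun s => by
      rw [← Equiv.sum_comp g]
      exact Finset.sum_congr rfl fun r _ => by simp [mul_comm]
    simp only [h3, h]
    by_cases hpq : p = q
    · subst hpq; simp
    · rw [Matrix.trace_single_eq_of_ne _ _ _ (Ne.symm hpq), Matrix.one_apply_ne hpq]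
  · intro X
    ext s t
    rw [hX]
    simp only [traceRight, Matrix.of_apply, Matrix.mul_apply, Matrix.conjTranspose_apply,
      star_star, Finset.sum_mul, Finset.mul_sum]
    have h4 : ∀ p q : m, ∑ r, X p q * (star (D r (e p, s)) * D r (e q, t)) =
        ∑ y, star (D (g.symm y) (e p, s)) * X p q * D (g.symm y) (e q, t) := fun p q => by
      rw [← Equiv.sum_comp g]
      exact Finset.sum_congr rfl fun r _ => by simp only [Equiv.symm_apply_apply]; ring
    simp only [h4]
    rw [Finset.sum_comm' (t' := Finset.univ) (s' := fun _ => Finset.univ) (by simp)]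
    rw [Finset.sum_congr rfl fun q _ => Finset.sum_comm]
    rw [Finset.sum_comm]

end AssistedCoherence

open AssistedCoherence

namespace AssistedCoherence

/-! ### Square roots and fidelity -/

section Fidelity

variable {m n s : Type*} [Fintype m] [DecidableEq m] [Fintype n] [DecidableEq n] [Fintype s]
  [DecidableEq s]

/-! The two sets of achievable rates are equal. Once Alice's output is discarded, let t_i be the
vector of ER that accompanies Bob's basis state i in U|ψ⟩. Bob's output state X is the Gram matrix
X_ij = ⟨t_j, t_i⟩ (`marginal_tauVec`), and its squared fidelity with Ψ_d is (1/d) ∑ X_ij = ‖∑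
t_i‖²/d.

From distillation to extraction, take f = id and compare the dephased state with π ⊗ |w⟩⟨w|, where w
is the unit vector along ∑ t_i. The fidelity is ∑ |⟨w, t_i⟩|/√d, which by the triangle inequality is
at least ‖∑ t_i‖/√d (`dSec_finalState_id_le`).

From extraction to distillation, the hash has to be replaced by a coherent operation. A positive
matrix H = D†D whose blocks on the fibres of f are identities yields Kraus operators K_s = ∑_i
conj(D_si) |f(i)⟩⟨i|. They are incoherent and complete, and the entries of their output sum to ∑
H_ij X_ij (`exists_hash_mem_ops`). Polar decomposition and Cauchy–Schwarz bound the squared fidelity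
of the hashed state with π ⊗ σ by ∑ H_ij X_ij / l, for some H depending on σ
(`exists_hashKernel_fidelity_sq_le`). Such H form a compact set, so a maximising H serves all σ at
once (`exists_purifiedDistance_le_dSec`).

Only three properties of the classes matter: they are closed under composition, contain local
operations with incoherent Kraus operators, and lie in QIP. The last gives the maxima: Λ(1) is
diagonal in Bob's basis and ρ ≤ 1, so ∑ X_ij ≤ |A||B| (`re_sum_traceLeft_le`), which bounds |B'|
when ε < 1. -/

lemma sqrt_eq_of_mul_self {A B : Matrix m m ℂ} (hB : B.PosSemidef) (h : B * B = A) :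
    CFC.sqrt A = B :=
  CFC.sqrt_unique h hB.nonneg

lemma posSemidef_sqrt (A : Matrix m m ℂ) : (CFC.sqrt A).PosSemidef :=
  Matrix.nonneg_iff_posSemidef.mp (CFC.sqrt_nonneg A)

lemma sqrt_mul_sqrt {A : Matrix m m ℂ} (hA : A.PosSemidef) : CFC.sqrt A * CFC.sqrt A = A :=
  CFC.sqrt_mul_sqrt_self A hA.nonneg

lemma sqrt_diagonal_kronecker {a : m → ℝ} (ha : ∀ i, 0 ≤ a i) {P : Matrix n n ℂ}
    (hP : P.PosSemidef) :
    CFC.sqrt (Matrix.diagonal (fun i => (a i : ℂ)) ⊗ₖ P) =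
      Matrix.diagonal (fun i => ((√(a i) : ℝ) : ℂ)) ⊗ₖ CFC.sqrt P := by
  refine sqrt_eq_of_mul_self (Matrix.PosSemidef.kronecker (Matrix.PosSemidef.diagonal fun i => ?_)
    (posSemidef_sqrt P)) ?_
  · simp [Complex.zero_le_real]
  · rw [← Matrix.mul_kronecker_mul, Matrix.diagonal_mul_diagonal, sqrt_mul_sqrt hP]
    simp_rw [← Complex.ofReal_mul, Real.mul_self_sqrt (ha _)]

/-- The polar decomposition of a rectangular matrix, with a contraction. -/
lemma exists_contraction_mul_eq_sqrt (Z : Matrix n m ℂ) :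
    ∃ V : Matrix m n ℂ, (1 - Vᴴ * V).PosSemidef ∧ V * Z = CFC.sqrt (Zᴴ * Z) := by
  have hS : (Zᴴ * Z).PosSemidef := Matrix.posSemidef_conjTranspose_mul_self Z
  have hSA : IsSelfAdjoint (Zᴴ * Z) := hS.isHermitian
  set S := Zᴴ * Z with hSdef
  have hnn : ∀ x ∈ spectrum ℝ S, 0 ≤ x := fun x hx => spectrum_nonneg_of_nonneg hS.nonneg hx
  have hc : ∀ g : ℝ → ℝ, ContinuousOn g (spectrum ℝ S) := fun g =>
    (Matrix.finite_real_spectrum (A := S)).continuousOn g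
  -- Since `0⁻¹ = 0`, this is the pseudo-inverse of √S; Z need not have full rank.
  let Q := cfc (fun x : ℝ => (√x)⁻¹) S
  have hQ : Qᴴ = Q := (cfc_predicate (R := ℝ) (p := IsSelfAdjoint) (fun x : ℝ => (√x)⁻¹) S)
  have hQS : Q * S = cfc (fun x : ℝ => √x) S := by
    simp only [Q]
    nth_rewrite 2 [← cfc_id ℝ S hSA]
    rw [← cfc_mul _ _ S (hc _) (hc _)]
    refine cfc_congr fun x hx => ?_
    have := hnn x hx
    rcases eq_or_lt_of_le this with h | h
    · simp [← h]
    · have : √x ≠ 0 := (Real.sqrt_pos.mpr h).ne'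
      field_simp
      simp [Real.sq_sqrt h.le]
  have hQSQQ : Q * S * Q * Q = Q := by
    rw [hQS]
    simp only [Q]
    rw [← cfc_mul _ _ S (hc _) (hc _), ← cfc_mul _ _ S (hc _) (hc _)]
    refine cfc_congr fun x hx => ?_
    by_cases h : √x = 0
    · simp [h]
    · field_simp
  -- With this V, the matrix V†V is a projection R, hence 1 - R = (1 - R)†(1 - R) is positive.
  refine ⟨Q * Zᴴ, ?_, ?_⟩
  · set R := (Q * Zᴴ)ᴴ * (Q * Zᴴ) with hR
    have hR1 : R = Z * (Q * Q) * Zᴴ := by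
      simp only [hR, Matrix.conjTranspose_mul, Matrix.conjTranspose_conjTranspose, hQ,
        Matrix.mul_assoc]
    have hRR : R * R = R := by
      have : R * R = Z * (Q * (Q * S * Q * Q)) * Zᴴ := by
        rw [hR1, hSdef]; simp only [Matrix.mul_assoc]
      rw [this, hQSQQ, hR1]
    have hRH : Rᴴ = R := by simp [hR, Matrix.mul_assoc]
    have : 1 - R = (1 - R)ᴴ * (1 - R) := by
      rw [Matrix.conjTranspose_sub, hRH, Matrix.conjTranspose_one, mul_sub, sub_mul, sub_mul, hRR]
      simp
    rw [this]
    exact Matrix.posSemidef_conjTranspose_mul_self _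
  · rw [Matrix.mul_assoc, ← hSdef, hQS, CFC.sqrt_eq_real_sqrt S hS.nonneg, cfcₙ_eq_cfc]

omit [DecidableEq m] [DecidableEq n] in
lemma IsState.kronecker {ρ : Matrix m m ℂ} {σ : Matrix n n ℂ} (hρ : IsState ρ) (hσ : IsState σ) :
    IsState (ρ ⊗ₖ σ) :=
  ⟨hρ.1.kronecker hσ.1, by rw [Matrix.trace_kronecker, hρ.2, hσ.2, one_mul]⟩

/-! ### Maximally mixed, pure and maximally coherent states -/

lemma maxMixed_eq_diagonal (d : ℕ) :
    maxMixed d = Matrix.diagonal fun _ => ((1 / (d : ℝ) : ℝ) : ℂ) := by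
  ext i j
  by_cases h : i = j <;> simp [maxMixed, h]

lemma isState_maxMixed {d : ℕ} (hd : 0 < d) : IsState (maxMixed d) := by
  rw [maxMixed_eq_diagonal]
  refine ⟨Matrix.PosSemidef.diagonal fun i => ?_, ?_⟩
  · simp only [Pi.zero_apply, Complex.zero_le_real]; positivity
  · simp [hd.ne']

omit [DecidableEq m] in
lemma isState_proj {v : m → ℂ} (hv : ∑ i, ‖v i‖ ^ 2 = 1) : IsState (proj v) := by
  refine ⟨Matrix.posSemidef_vecMulVec_self_star v, ?_⟩
  simp only [Matrix.trace, Matrix.diag_apply, proj, Matrix.vecMulVec_apply, Pi.star_apply,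
    RCLike.star_def, Complex.mul_conj']
  exact_mod_cast hv

lemma isState_maxCoherent {d : ℕ} (hd : 0 < d) : IsState (maxCoherent d) := by
  apply isState_proj
  simp [hd.ne']

omit [DecidableEq m] in
/-- `|v⟩⟨v| A |v⟩⟨v| = ⟨v|A|v⟩ |v⟩⟨v|`. -/
lemma proj_mul_mul_proj (v : m → ℂ) (A : Matrix m m ℂ) :
    proj v * A * proj v = (star v ⬝ᵥ A *ᵥ v) • proj v := by
  simp only [proj]
  rw [Matrix.vecMulVec_mul, Matrix.vecMulVec_mul_vecMulVec, Matrix.dotProduct_mulVec]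
  ext i j
  simp [Matrix.vecMulVec_apply]
  ring

lemma sqrt_proj {v : m → ℂ} (hv : ∑ i, ‖v i‖ ^ 2 = 1) : CFC.sqrt (proj v) = proj v := by
  refine sqrt_eq_of_mul_self (isState_proj hv).1 ?_
  have h : star v ⬝ᵥ v = 1 := by
    simp only [dotProduct, Pi.star_apply, RCLike.star_def, Complex.conj_mul']
    exact_mod_cast hv
  have := proj_mul_mul_proj v 1
  rwa [Matrix.mul_one, Matrix.one_mulVec, h, one_smul] at this

/-- The correction term of the generalized fidelity vanishes because σ has trace one. -/
lemma fidelity_eq {ρ σ : Matrix m m ℂ} (hρ : ρ.PosSemidef) (hσ : IsState σ) :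
    fidelity ρ σ = (CFC.sqrt (CFC.sqrt σ * ρ * CFC.sqrt σ)).trace.re := by
  have h : (CFC.sqrt ρ * CFC.sqrt σ)ᴴ * (CFC.sqrt ρ * CFC.sqrt σ) =
      CFC.sqrt σ * ρ * CFC.sqrt σ := by
    rw [Matrix.conjTranspose_mul, (posSemidef_sqrt ρ).isHermitian.eq,
      (posSemidef_sqrt σ).isHermitian.eq, Matrix.mul_assoc, ← Matrix.mul_assoc (CFC.sqrt ρ),
      sqrt_mul_sqrt hρ, Matrix.mul_assoc]
  rw [fidelity, traceNorm, h]
  simp [hσ.2]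

lemma fidelity_nonneg {ρ σ : Matrix m m ℂ} : 0 ≤ fidelity ρ σ :=
  add_nonneg (Complex.nonneg_iff.mp (posSemidef_sqrt _).trace_nonneg).1 (Real.sqrt_nonneg _)

/-- Reduces both directions of the theorem to fidelity inequalities, between states of different
systems. -/
lemma purifiedDistance_anti {ρ σ : Matrix m m ℂ} {ρ' σ' : Matrix n n ℂ}
    (h : fidelity ρ σ ≤ fidelity ρ' σ') : purifiedDistance ρ' σ' ≤ purifiedDistance ρ σ :=
  Real.sqrt_le_sqrt (sub_le_sub_left (pow_le_pow_left₀ fidelity_nonneg h 2) 1)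

omit [DecidableEq m] in
lemma sum_sum_nonneg {A : Matrix m m ℂ} (hA : A.PosSemidef) : 0 ≤ ∑ i, ∑ j, A i j := by
  have := hA.dotProduct_mulVec_nonneg fun _ => 1
  simpa [dotProduct, Matrix.mulVec] using this

/-- The target is pure, so the fidelity is the root of ⟨Ψ|X|Ψ⟩, and Ψ has constant amplitudes 1/√d.
-/
lemma fidelity_maxCoherent {d : ℕ} (hd : 0 < d) {X : Matrix (Fin d) (Fin d) ℂ}
    (hX : X.PosSemidef) :
    fidelity X (maxCoherent d) = √((∑ i, ∑ j, X i j).re / d) := by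
  have hv : ∑ _i : Fin d, ‖((1 / √(d : ℝ) : ℝ) : ℂ)‖ ^ 2 = 1 := by simp [hd.ne']
  rw [fidelity_eq hX (isState_maxCoherent hd), maxCoherent, sqrt_proj hv, proj_mul_mul_proj]
  set v : Fin d → ℂ := fun _ => ((1 / √(d : ℝ) : ℝ) : ℂ) with hvdef
  set q : ℝ := (∑ i, ∑ j, X i j).re / d
  have hnn := Complex.nonneg_iff.mp (sum_sum_nonneg hX)
  have hq : star v ⬝ᵥ X *ᵥ v = (q : ℂ) := by
    have h1 : (∑ i, ∑ j, X i j) = (((∑ i, ∑ j, X i j).re : ℝ) : ℂ) :=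
      Complex.ext rfl (by simpa using hnn.2.symm)
    have h2 : star v ⬝ᵥ X *ᵥ v = (∑ i, ∑ j, X i j) * ((1 / √(d : ℝ) * (1 / √(d : ℝ)) : ℝ) : ℂ) := by
      simp only [dotProduct, Matrix.mulVec, hvdef, Finset.sum_mul, Finset.mul_sum, Pi.star_apply,
        RCLike.star_def, Complex.conj_ofReal, Complex.ofReal_mul]
      exact Finset.sum_congr rfl fun i _ => Finset.sum_congr rfl fun j _ => by ring
    rw [h2, h1, ← Complex.ofReal_mul]
    congr 1
    rw [div_mul_div_comm, Real.mul_self_sqrt (by positivity)]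
    simp [q, div_eq_mul_inv]
  have hq0 : 0 ≤ q := div_nonneg hnn.1 (by positivity)
  have hs : CFC.sqrt ((q : ℂ) • proj v) = ((√q : ℝ) : ℂ) • proj v := by
    refine sqrt_eq_of_mul_self ((isState_proj hv).1.smul ?_) ?_
    · exact Complex.zero_le_real.mpr (Real.sqrt_nonneg q)
    · have hpp : proj v * proj v = proj v := by
        have := sqrt_mul_sqrt (isState_proj hv).1
        rwa [sqrt_proj hv] at this
      rw [Matrix.smul_mul, Matrix.mul_smul, hpp, smul_smul, ← Complex.ofReal_mul,
        Real.mul_self_sqrt hq0]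
  rw [hq, hs, Matrix.trace_smul, (isState_proj hv).2]
  simp

/-- A factor of the state that results from hashing a dephased pure state. -/
def hashFactor {c l : ℕ} (f : Fin c → Fin l) (t : Fin c × s → ℂ) : Matrix (Fin l × s) (Fin c) ℂ :=
  Matrix.of fun p i => if f i = p.1 then t (i, p.2) else 0

omit [Fintype s] [DecidableEq s] in
lemma applyHash_dephaseLeft_proj {c l : ℕ} (f : Fin c → Fin l) (t : Fin c × s → ℂ) :
    applyHash f (dephaseLeft (proj t)) = hashFactor f t * (hashFactor f t)ᴴ := by
  ext ⟨l₁, x⟩ ⟨l₂, y⟩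
  rw [Matrix.mul_apply, applyHash, Matrix.sum_apply]
  refine Finset.sum_congr rfl fun i _ => ?_
  simp only [hashFactor, dephaseLeft, proj, Matrix.vecMulVec_apply, Matrix.kroneckerMap_apply,
    Matrix.single_apply, Matrix.of_apply, Matrix.conjTranspose_apply, Pi.star_apply]
  split_ifs <;> simp_all

omit [DecidableEq s] in
lemma posSemidef_applyHash_dephaseLeft_proj {c l : ℕ} (f : Fin c → Fin l) (t : Fin c × s → ℂ) :
    (applyHash f (dephaseLeft (proj t))).PosSemidef := by
  rw [applyHash_dephaseLeft_proj]
  exact Matrix.posSemidef_self_mul_conjTranspose _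

/-- The fidelity of a dephased pure state with `π ⊗ |w⟩⟨w|`. -/
lemma fidelity_dephase_maxMixed_proj {d : ℕ} (hd : 0 < d) (t : Fin d × s → ℂ) {w : s → ℂ}
    (hw : ∑ x, ‖w x‖ ^ 2 = 1) :
    fidelity (applyHash id (dephaseLeft (proj t))) (maxMixed d ⊗ₖ proj w) =
      (∑ i, ‖∑ x, star (w x) * t (i, x)‖) / √d := by
  rw [fidelity_eq (posSemidef_applyHash_dephaseLeft_proj _ _)
    ((isState_maxMixed hd).kronecker (isState_proj hw)), maxMixed_eq_diagonal,
    sqrt_diagonal_kronecker (fun _ => by positivity) (isState_proj hw).1, sqrt_proj hw]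
  -- The projection onto w turns the block of label i into |⟨w, t_i⟩|² |w⟩⟨w|, so the root can be
  -- taken entrywise on the first factor.
  have key : Matrix.diagonal (fun _ : Fin d => ((√(1 / (d : ℝ)) : ℝ) : ℂ)) ⊗ₖ proj w *
      applyHash id (dephaseLeft (proj t)) *
      Matrix.diagonal (fun _ : Fin d => ((√(1 / (d : ℝ)) : ℝ) : ℂ)) ⊗ₖ proj w =
      Matrix.diagonal (fun i : Fin d =>
        ((‖∑ x, star (w x) * t (i, x)‖ ^ 2 / d : ℝ) : ℂ)) ⊗ₖ proj w := by
    simp only [applyHash, Matrix.mul_sum, Matrix.sum_mul, ← Matrix.mul_kronecker_mul, id_eq]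
    ext ⟨i, x⟩ ⟨j, y⟩
    rw [Matrix.sum_apply]
    simp only [Matrix.kroneckerMap_apply, proj_mul_mul_proj, Matrix.diagonal_mul,
      Matrix.mul_diagonal, Matrix.smul_apply, smul_eq_mul, Matrix.single_apply]
    rw [Finset.sum_eq_single i]
    · by_cases hij : i = j
      · subst hij
        have h1 : ((√(1 / (d : ℝ)) : ℝ) : ℂ) * 1 * ((√(1 / (d : ℝ)) : ℝ) : ℂ) = 1 / (d : ℂ) := by
          rw [mul_one, ← Complex.ofReal_mul, Real.mul_self_sqrt (by positivity)]
          simp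
        have h2 : star w ⬝ᵥ (Matrix.of fun p q => dephaseLeft (proj t) (i, p) (i, q)) *ᵥ w =
            ((‖∑ x, star (w x) * t (i, x)‖ ^ 2 : ℝ) : ℂ) := by
          rw [Complex.ofReal_pow, ← Complex.mul_conj']
          simp only [dotProduct, Matrix.mulVec, dephaseLeft, proj, Matrix.of_apply, if_true,
            Matrix.vecMulVec_apply, Pi.star_apply, map_sum, map_mul, RCLike.star_def,
            Complex.conj_conj]
          rw [Finset.sum_mul_sum]
          simp only [Finset.mul_sum]
          exact Finset.sum_congr rfl fun i _ => Finset.sum_congr rfl fun j _ => by ring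
        simp only [and_self, if_true, h1, h2, Matrix.diagonal_apply_eq]
        push_cast
        ring
      · simp [hij]
    · intro k _ hk
      simp [hk]
    · simp
  rw [key, sqrt_diagonal_kronecker (fun _ => by positivity) (isState_proj hw).1, sqrt_proj hw,
    Matrix.trace_kronecker, (isState_proj hw).2, Matrix.trace_diagonal, mul_one, Complex.re_sum,
    Finset.sum_div]
  refine Finset.sum_congr rfl fun i _ => ?_
  rw [Complex.ofReal_re, Real.sqrt_div (by positivity), Real.sqrt_sq (norm_nonneg _)]

end Fidelity

/-! ### Kernels of Bob's operations for a hash function -/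

section Kernel

variable {s : Type*} [Fintype s] [DecidableEq s] {c l : ℕ}

/-- Positive kernels whose blocks on the fibres of `f` are identities. -/
def hashKernels (f : Fin c → Fin l) : Set (Matrix (Fin c) (Fin c) ℂ) :=
  {H | H.PosSemidef ∧ ∀ i j, f i = f j → H i j = (1 : Matrix (Fin c) (Fin c) ℂ) i j}

/-- The reduced state on the first system of the pure state `t`. -/
def marginal (t : Fin c × s → ℂ) : Matrix (Fin c) (Fin c) ℂ :=
  Matrix.of fun i j => ∑ x, t (i, x) * star (t (j, x))

omit [DecidableEq s] in
lemma posSemidef_marginal (t : Fin c × s → ℂ) : (marginal t).PosSemidef := by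
  have : marginal t = (Matrix.of fun i x => t (i, x)) * (Matrix.of fun i x => t (i, x))ᴴ := by
    ext i j
    simp [marginal, Matrix.mul_apply]
  rw [this]
  exact Matrix.posSemidef_self_mul_conjTranspose _

lemma re_sum_mul_nonneg {A B : Matrix (Fin c) (Fin c) ℂ} (hA : A.PosSemidef)
    (hB : B.PosSemidef) : 0 ≤ (∑ i, ∑ j, A i j * B i j).re :=
  (Complex.nonneg_iff.mp (sum_sum_nonneg (hA.hadamard hB))).1

/-- The part of `V` in which the row label agrees with the hash of the column. -/
def matchedPart (f : Fin c → Fin l) (V : Matrix (Fin l × s) (Fin c) ℂ) : Matrix s (Fin c) ℂ :=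
  Matrix.of fun y i => V (f i, y) i

/-- With E_k the projection onto row label k, V†E_kV ≤ V†V ≤ 1. Compressing 1 - V†E_kV to the fibre
of k and summing over k gives the matrix in question. -/
lemma posSemidef_one_sub_pinching (f : Fin c → Fin l) {V : Matrix (Fin l × s) (Fin c) ℂ}
    (hV : (1 - Vᴴ * V).PosSemidef) :
    (1 - Matrix.of fun i j => if f i = f j then ((matchedPart f V)ᴴ * matchedPart f V) i j
      else 0).PosSemidef := by
  let P : Fin l → Matrix (Fin c) (Fin c) ℂ := fun k => Matrix.diagonal fun i =>
    if f i = k then 1 else 0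
  let E : Fin l → Matrix (Fin l × s) (Fin l × s) ℂ := fun k => Matrix.diagonal fun p =>
    if p.1 = k then 1 else 0
  have h1 : ∀ k, (1 - Vᴴ * E k * V).PosSemidef := by
    intro k
    have : 1 - Vᴴ * E k * V = (1 - Vᴴ * V) + Vᴴ * (1 - E k) * V := by
      rw [Matrix.mul_sub, Matrix.sub_mul, Matrix.mul_one]; abel
    rw [this]
    refine hV.add (Matrix.PosSemidef.conjTranspose_mul_mul_same ?_ V)
    have : 1 - E k = Matrix.diagonal fun p : Fin l × s => if p.1 = k then (0 : ℂ) else 1 := by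
      rw [← Matrix.diagonal_one, Matrix.diagonal_sub]
      congr 1; ext p; split_ifs <;> simp
    rw [this]
    refine Matrix.PosSemidef.diagonal fun p => ?_
    dsimp only [Pi.zero_apply]; split_ifs <;> simp
  have h2 : (1 - Matrix.of fun i j => if f i = f j then
      ((matchedPart f V)ᴴ * matchedPart f V) i j else 0) =
      ∑ k, P k * (1 - Vᴴ * E k * V) * (P k)ᴴ := by
    ext i j
    rw [Matrix.sum_apply]
    simp only [P, Matrix.diagonal_conjTranspose, Matrix.diagonal_mul, Matrix.mul_diagonal,
      Matrix.sub_apply, Matrix.of_apply, Pi.star_apply, apply_ite star, star_one, star_zero]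
    rw [Finset.sum_eq_single (f i)]
    · by_cases hij : f i = f j
      · simp only [hij, if_true, one_mul, mul_one]
        congr 1
        rw [Matrix.mul_apply, Matrix.mul_apply, Fintype.sum_prod_type]
        simp only [E, Matrix.mul_diagonal, matchedPart, Matrix.conjTranspose_apply,
          Matrix.of_apply]
        rw [Finset.sum_eq_single (f j) (fun k _ hk => by simp [hk]) (by simp)]
        simp [hij]
      · have : i ≠ j := fun h => hij (by rw [h])
        simp [hij, this, Ne.symm hij]
    · intro k _ hk
      simp [hk.symm]
    · simp
  rw [h2]
  exact Matrix.posSemidef_sum _ fun k _ => (h1 k).mul_mul_conjTranspose_same _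

/-- The fidelity of a hashed dephased pure state with `π ⊗ σ` is bounded by a value that a
kernel for the hash function achieves. -/
lemma exists_hashKernel_fidelity_sq_le (hl : 0 < l) (f : Fin c → Fin l) (t : Fin c × s → ℂ)
    {σ : Matrix s s ℂ} (hσ : IsState σ) :
    ∃ H ∈ hashKernels f, fidelity (applyHash f (dephaseLeft (proj t))) (maxMixed l ⊗ₖ σ) ^ 2 ≤
      (∑ i, ∑ j, H i j * marginal t i j).re / l := by
  set S := CFC.sqrt σ with hS
  set M := hashFactor f t with hM
  set R : Matrix (Fin l × s) (Fin l × s) ℂ :=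
    Matrix.diagonal (fun _ : Fin l => ((√(1 / (l : ℝ)) : ℝ) : ℂ)) ⊗ₖ S with hR
  have hRs : CFC.sqrt (maxMixed l ⊗ₖ σ) = R := by
    rw [maxMixed_eq_diagonal, sqrt_diagonal_kronecker (fun _ => by positivity) hσ.1]
  have hRH : Rᴴ = R := by rw [← hRs]; exact (posSemidef_sqrt _).isHermitian
  obtain ⟨V, hV, hVZ⟩ := exists_contraction_mul_eq_sqrt (Mᴴ * R)
  set W := matchedPart f V with hW
  -- What W†W lacks for its fibre blocks to be identities; adding this positive matrix makes it a
  -- kernel.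
  let N : Matrix (Fin c) (Fin c) ℂ :=
    1 - Matrix.of fun i j => if f i = f j then (Wᴴ * W) i j else 0
  have hN : N.PosSemidef := posSemidef_one_sub_pinching f hV
  refine ⟨Wᴴ * W + N, ⟨(Matrix.posSemidef_conjTranspose_mul_self W).add hN, fun i j hij => ?_⟩, ?_⟩
  · simp [N, hij]
  have hadd : (∑ i, ∑ j, (Wᴴ * W + N) i j * marginal t i j).re =
      (∑ i, ∑ j, (Wᴴ * W) i j * marginal t i j).re + (∑ i, ∑ j, N i j * marginal t i j).re := by
    simp only [Matrix.add_apply, add_mul, Finset.sum_add_distrib, Complex.add_re]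
  -- The fidelity becomes a scalar product of S = √σ with Y, and the squared norm of Y is the value
  -- of W†W on the marginal.
  let Y : s × s → ℂ := fun p => ∑ i, star (t (i, p.1)) * W p.2 i
  have hF : fidelity (applyHash f (dephaseLeft (proj t))) (maxMixed l ⊗ₖ σ) =
      √(1 / (l : ℝ)) * (∑ p : s × s, S p.1 p.2 * Y p).re := by
    have h1 : R * applyHash f (dephaseLeft (proj t)) * R = (Mᴴ * R)ᴴ * (Mᴴ * R) := by
      rw [applyHash_dephaseLeft_proj, Matrix.conjTranspose_mul, hRH,
        Matrix.conjTranspose_conjTranspose]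
      simp only [Matrix.mul_assoc, hM]
    rw [fidelity_eq (posSemidef_applyHash_dephaseLeft_proj _ _)
      ((isState_maxMixed hl).kronecker hσ), hRs, h1, ← hVZ, ← Complex.re_ofReal_mul]
    congr 1
    have h2 : ∀ i y, (Mᴴ * R) i y = ((√(1 / (l : ℝ)) : ℝ) : ℂ) *
        if f i = y.1 then ∑ x, star (t (i, x)) * S x y.2 else 0 := by
      rintro i ⟨k, y⟩
      simp only [Matrix.mul_apply, Matrix.conjTranspose_apply, hM, hashFactor, hR,
        Matrix.of_apply, Fintype.sum_prod_type, Matrix.kroneckerMap_apply, Matrix.diagonal_apply]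
      rw [Finset.sum_eq_single k (fun k' _ hk => by simp [hk]) (by simp)]
      by_cases h : f i = k
      · simp only [h, if_true, Finset.mul_sum]
        exact Finset.sum_congr rfl fun x _ => by ring
      · simp [h]
    -- Column i of V is paired only with rows labelled f(i), so only the matched part W survives.
    have h3 : ∀ i, ∑ p, V p i * (Mᴴ * R) i p =
        ∑ x, ∑ y, ((√(1 / (l : ℝ)) : ℝ) : ℂ) * (S x y * (star (t (i, x)) * W y i)) := by
      intro i
      simp only [h2, Fintype.sum_prod_type]
      rw [Finset.sum_eq_single (f i) (fun k _ hk => by simp [hk.symm]) (by simp), Finset.sum_comm]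
      refine Finset.sum_congr rfl fun y _ => ?_
      simp only [if_true, Finset.mul_sum, hW, matchedPart, Matrix.of_apply]
      exact Finset.sum_congr rfl fun x _ => by ring
    simp only [Matrix.trace, Matrix.diag_apply, Matrix.mul_apply (M := V)]
    rw [Finset.sum_comm]
    simp only [h3, Fintype.sum_prod_type, Finset.mul_sum, Y]
    rw [Finset.sum_comm]
    exact Finset.sum_congr rfl fun x _ => Finset.sum_comm
  have hSS : ∑ p : s × s, ‖S p.1 p.2‖ ^ 2 = 1 := by
    have h1 : (Sᴴ * S).trace = 1 := by
      rw [(posSemidef_sqrt σ).isHermitian.eq, sqrt_mul_sqrt hσ.1, hσ.2]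
    rw [Matrix.trace] at h1
    simp only [Matrix.diag_apply, Matrix.mul_apply, Matrix.conjTranspose_apply, RCLike.star_def,
      Complex.conj_mul'] at h1
    rw [Fintype.sum_prod_type, Finset.sum_comm]
    exact_mod_cast h1
  have hYY : ∑ p, ‖Y p‖ ^ 2 = (∑ i, ∑ j, (Wᴴ * W) i j * marginal t i j).re := by
    have : ((∑ p, ‖Y p‖ ^ 2 : ℝ) : ℂ) = ∑ i, ∑ j, (Wᴴ * W) i j * marginal t i j := by
      push_cast
      simp only [← Complex.conj_mul', Y, map_sum, map_mul, RCLike.star_def, Complex.conj_conj,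
        Matrix.mul_apply, Matrix.conjTranspose_apply, marginal, Matrix.of_apply,
        Finset.sum_mul_sum, Fintype.sum_prod_type]
      rw [Finset.sum_comm' (t' := Finset.univ) (s' := fun _ => Finset.univ) (by simp)]
      rw [Finset.sum_congr rfl fun y _ => Finset.sum_comm, Finset.sum_comm]
      refine Finset.sum_congr rfl fun i _ => ?_
      rw [Finset.sum_congr rfl fun y _ => Finset.sum_comm, Finset.sum_comm]
      refine Finset.sum_congr rfl fun j _ => Finset.sum_congr rfl fun y _ =>
        Finset.sum_congr rfl fun x _ => by ring
    rw [← this, Complex.ofReal_re]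
  have hCS : (∑ p : s × s, S p.1 p.2 * Y p).re ^ 2 ≤ ∑ p, ‖Y p‖ ^ 2 := by
    calc (∑ p : s × s, S p.1 p.2 * Y p).re ^ 2
        ≤ ‖∑ p : s × s, S p.1 p.2 * Y p‖ ^ 2 := by
          rw [← sq_abs]
          exact pow_le_pow_left₀ (abs_nonneg _) (Complex.abs_re_le_norm _) 2
      _ ≤ (∑ p : s × s, ‖S p.1 p.2‖ * ‖Y p‖) ^ 2 := by
          refine pow_le_pow_left₀ (norm_nonneg _) ((norm_sum_le _ _).trans ?_) 2
          simp only [norm_mul, le_refl]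
      _ ≤ (∑ p : s × s, ‖S p.1 p.2‖ ^ 2) * ∑ p, ‖Y p‖ ^ 2 :=
          Finset.sum_mul_sq_le_sq_mul_sq _ _ _
      _ = ∑ p, ‖Y p‖ ^ 2 := by rw [hSS, one_mul]
  rw [hF, hadd, ← hYY, mul_pow, Real.sq_sqrt (by positivity), one_div, inv_mul_eq_div]
  gcongr
  -- The added part N only increases the value, by the Schur product theorem.
  have := re_sum_mul_nonneg hN (posSemidef_marginal t)
  linarith

/-- The unit diagonal makes the columns of a factor D unit vectors, so Cauchy–Schwarz bounds every
entry of D†D by 1. -/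
lemma isCompact_hashKernels (f : Fin c → Fin l) : IsCompact (hashKernels f) := by
  have hle : ∀ H ∈ hashKernels f, ∀ i j, ‖H i j‖ ≤ 1 := by
    rintro H ⟨hH, hd⟩ i j
    obtain ⟨D, rfl⟩ := CStarAlgebra.nonneg_iff_eq_star_mul_self.mp hH.nonneg
    rw [Matrix.star_eq_conjTranspose] at hd ⊢
    have hcol : ∀ i, ∑ k, ‖D k i‖ ^ 2 = 1 := by
      intro i
      have h := hd i i rfl
      simp only [Matrix.mul_apply, Matrix.conjTranspose_apply, RCLike.star_def, Complex.conj_mul',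
        Matrix.one_apply_eq] at h
      exact_mod_cast h
    have h1 : ‖(Dᴴ * D) i j‖ ≤ ∑ k, ‖D k i‖ * ‖D k j‖ := by
      rw [Matrix.mul_apply]
      refine (norm_sum_le _ _).trans (le_of_eq ?_)
      simp
    have h2 := Finset.sum_mul_sq_le_sq_mul_sq Finset.univ (fun k => ‖D k i‖) fun k => ‖D k j‖
    rw [hcol, hcol, one_mul] at h2
    exact h1.trans ((sq_le_one_iff₀ (by positivity)).mp h2)
  have hclosed : IsClosed (hashKernels f) := by
    have h1 : IsClosed {H : Matrix (Fin c) (Fin c) ℂ | H.PosSemidef} := by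
      simp only [Matrix.posSemidef_iff_dotProduct_mulVec, Set.ofPred_and, Set.ofPred_forall]
      refine IsClosed.inter (isClosed_eq (by fun_prop) (by fun_prop)) (isClosed_iInter fun x => ?_)
      exact isClosed_le continuous_const (by fun_prop)
    have h2 : IsClosed {H : Matrix (Fin c) (Fin c) ℂ | ∀ i j, f i = f j →
        H i j = (1 : Matrix (Fin c) (Fin c) ℂ) i j} := by
      simp only [Set.ofPred_forall]
      exact isClosed_iInter fun i => isClosed_iInter fun j => isClosed_iInter fun _ =>
        isClosed_eq (by fun_prop) continuous_const
    exact h1.inter h2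
  have hK : IsCompact (Set.univ.pi fun _ : Fin c => Set.univ.pi fun _ : Fin c =>
      Metric.closedBall (0 : ℂ) 1) :=
    isCompact_univ_pi fun _ => isCompact_univ_pi fun _ => isCompact_closedBall _ _
  exact hK.of_isClosed_subset hclosed fun H hH i _ j _ => by simpa using hle H hH i j

end Kernel

/-! ### Kraus representations -/

section Kraus

variable {m n : Type*} [Fintype m] [Fintype n] {k : ℕ}

/-- The completely positive map with Kraus operators `K`. -/
def krausOp (K : Fin k → Matrix n m ℂ) : Op m n where
  toFun X := ∑ s, K s * X * (K s)ᴴ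
  map_add' X Y := by simp only [Matrix.mul_add, Matrix.add_mul, Finset.sum_add_distrib]
  map_smul' z X := by simp [Finset.smul_sum]

omit [Fintype n] in
lemma krausOp_apply (K : Fin k → Matrix n m ℂ) (X : Matrix m m ℂ) :
    krausOp K X = ∑ s, K s * X * (K s)ᴴ := rfl

omit [Fintype n] in
lemma krausOp_entry (K : Fin k → Matrix n m ℂ) (X : Matrix m m ℂ) (p q : n) :
    krausOp K X p q = ∑ s, ∑ i, ∑ j, K s p i * X i j * star (K s q j) := by
  rw [krausOp_apply, Matrix.sum_apply]
  refine Finset.sum_congr rfl fun s _ => ?_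
  simp only [Matrix.mul_apply, Matrix.conjTranspose_apply, Finset.sum_mul]
  exact Finset.sum_comm

omit [Fintype n] in
lemma mapRight_krausOp {a : Type*} [Fintype a] [DecidableEq a] (K : Fin k → Matrix n m ℂ) :
    mapRight a (krausOp K) = krausOp fun s => (1 : Matrix a a ℂ) ⊗ₖ K s := by
  ext X ⟨i, p⟩ ⟨j, q⟩
  rw [krausOp_entry]
  change krausOp K _ p q = _
  rw [krausOp_entry]
  simp [Fintype.sum_prod_type, Matrix.one_apply, apply_ite (starRingEnd ℂ)]

omit [Fintype n] in
lemma mapLeft_krausOp {a : Type*} [Fintype a] [DecidableEq a] (K : Fin k → Matrix n m ℂ) :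
    mapLeft (krausOp K) a = krausOp fun s => K s ⊗ₖ (1 : Matrix a a ℂ) := by
  ext X ⟨p, i⟩ ⟨q, j⟩
  rw [krausOp_entry]
  change krausOp K _ p q = _
  rw [krausOp_entry]
  simp [Fintype.sum_prod_type, Matrix.one_apply, apply_ite (starRingEnd ℂ)]

lemma posSemidef_krausOp (K : Fin k → Matrix n m ℂ) {X : Matrix m m ℂ} (hX : X.PosSemidef) :
    (krausOp K X).PosSemidef :=
  Matrix.posSemidef_sum _ fun s _ => hX.mul_mul_conjTranspose_same (K s)

lemma isCP_krausOp (K : Fin k → Matrix n m ℂ) : IsCP (krausOp K) := fun j X hX => by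
  rw [mapRight_krausOp]
  exact posSemidef_krausOp _ hX

lemma trace_krausOp [DecidableEq m] {K : Fin k → Matrix n m ℂ} (hK : ∑ s, (K s)ᴴ * K s = 1)
    (X : Matrix m m ℂ) : (krausOp K X).trace = X.trace := by
  rw [krausOp_apply, Matrix.trace_sum,
    Finset.sum_congr rfl fun s _ => Matrix.trace_mul_cycle (K s) X (K s)ᴴ]
  rw [← Matrix.trace_sum, ← Finset.sum_mul, hK, Matrix.one_mul]

/-- The composition of quantum operations. -/
def Channel.comp {l : Type*} [Fintype l] (Γ : Channel n l) (Λ : Channel m n) : Channel m l where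
  toOp := Γ.toOp ∘ₗ Λ.toOp
  cp j X hX := Γ.cp j _ (Λ.cp j X hX)
  tp X := (Γ.tp _).trans (Λ.tp X)

lemma Channel.posSemidef (Λ : Channel m n) {X : Matrix m m ℂ} (hX : X.PosSemidef) :
    (Λ.toOp X).PosSemidef :=
  (Λ.cp 1 _ (hX.submatrix Prod.snd)).submatrix fun j => ((0 : Fin 1), j)

lemma Channel.isState (Λ : Channel m n) {X : Matrix m m ℂ} (hX : IsState X) :
    IsState (Λ.toOp X) :=
  ⟨Λ.posSemidef hX.1, (Λ.tp X).trans hX.2⟩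

/-- A Kraus operator is incoherent iff every column has at most one nonzero entry. -/
lemma isIncoherentKraus_iff [DecidableEq m] {K : Matrix n m ℂ} :
    IsIncoherentKraus K ↔ ∀ j i i', i ≠ i' → K i j * star (K i' j) = 0 := by
  constructor
  · intro h j i i' hi
    have hs : IsIncoherentState (Matrix.single j j (1 : ℂ)) := by
      rw [← Matrix.diagonal_single]
      refine ⟨⟨Matrix.PosSemidef.diagonal fun i => ?_, by simp⟩, Matrix.isDiag_diagonal _⟩
      by_cases hij : i = j
      · subst hij; simp
      · simp [hij]
    have := (h _ hs).2 hi
    simpa [Matrix.mul_apply, Matrix.single_apply, ite_and] using this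
  · intro h ρ hρ
    refine ⟨hρ.1.1.mul_mul_conjTranspose_same K, fun i i' hi => ?_⟩
    change (K * ρ * Kᴴ) i i' = 0
    rw [Matrix.mul_apply]
    refine Finset.sum_eq_zero fun j _ => ?_
    rw [Matrix.mul_apply, Finset.sum_eq_single j (fun l _ hl => by rw [hρ.2 hl, mul_zero]) (by simp),
      Matrix.conjTranspose_apply, mul_right_comm, h j i i' hi, zero_mul]

lemma isIncoherentKraus_one [DecidableEq m] : IsIncoherentKraus (1 : Matrix m m ℂ) := by
  rw [isIncoherentKraus_iff]
  intro j i i' hi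
  by_cases h : i = j
  · subst h; simp [Ne.symm hi]
  · simp [Matrix.one_apply, h]

lemma IsIncoherentKraus.mul [DecidableEq m] [DecidableEq n] {l : Type*} [Fintype l]
    {K : Matrix l n ℂ} {L : Matrix n m ℂ} (hK : IsIncoherentKraus K) (hL : IsIncoherentKraus L) :
    IsIncoherentKraus (K * L) := by
  rw [isIncoherentKraus_iff] at *
  intro j i i' hi
  rw [Matrix.mul_apply, Matrix.mul_apply, star_sum, Finset.sum_mul_sum]
  refine Finset.sum_eq_zero fun p _ => Finset.sum_eq_zero fun q _ => ?_
  rw [StarMul.star_mul]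
  by_cases hpq : p = q
  · subst hpq
    linear_combination (L p j * star (L p j)) * hK p i i' hi
  · linear_combination (K i p * star (K i' q)) * hL j p q hpq

lemma isMIOInstrument_krausOp {d d' : ℕ} {K : Fin k → Matrix (Fin d') (Fin d) ℂ}
    (hK : ∑ s, (K s)ᴴ * K s = 1) (hinc : ∀ s, IsIncoherentKraus (K s)) :
    IsMIOInstrument (d' := fun _ : Fin 1 => d') fun _ => krausOp K := by
  refine ⟨⟨fun _ => isCP_krausOp K, fun X => by simp [trace_krausOp hK]⟩, fun ρ hρ _ =>
    ⟨posSemidef_krausOp _ hρ.1.1, fun i j hij => ?_⟩⟩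
  change krausOp K ρ i j = 0
  rw [krausOp_apply, Matrix.sum_apply]
  exact Finset.sum_eq_zero fun s _ => (hinc s ρ hρ).2 hij

/-- The Kraus operators `⟨s|` of the trace. -/
def traceKraus (d : ℕ) (s : Fin d) : Matrix (Fin 1) (Fin d) ℂ :=
  Matrix.of fun _ i => if i = s then 1 else 0

lemma sum_traceKraus (d : ℕ) : ∑ s, (traceKraus d s)ᴴ * traceKraus d s = 1 := by
  ext i j
  simp [Matrix.sum_apply, Matrix.mul_apply, traceKraus, Matrix.one_apply, eq_comm]

lemma isIncoherentKraus_traceKraus (d : ℕ) (s : Fin d) : IsIncoherentKraus (traceKraus d s) :=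
  isIncoherentKraus_iff.mpr fun _ _ _ hi => absurd (Subsingleton.elim _ _) hi

lemma krausOp_traceKraus (d : ℕ) (X : Matrix (Fin d) (Fin d) ℂ) :
    krausOp (traceKraus d) X = Matrix.of fun _ _ => X.trace := by
  ext p q
  simp [krausOp_entry, traceKraus, Matrix.trace]

end Kraus

/-! ### Closure properties of the free operations -/

section Free

variable {a b a' b' a'' b'' : ℕ}

/-- Operators that are block diagonal with respect to Bob's basis. -/
def IsBobDiag {m n : Type*} (X : Matrix (m × n) (m × n) ℂ) : Prop :=
  ∀ p q, p.2 ≠ q.2 → X p q = 0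

/-- The vanishing of the off-diagonal blocks is a linear condition, easier to propagate through
operations than a convex decomposition. Conversely, p and σ^b are the traces and the normalized
diagonal blocks. -/
lemma isQuantumIncoherent_iff {σ : Matrix (Fin a × Fin b) (Fin a × Fin b) ℂ} :
    IsQuantumIncoherent σ ↔ IsState σ ∧ IsBobDiag σ := by
  constructor
  · rintro ⟨p, s, hp, hp1, hs, rfl⟩
    have hsingle : ∀ i : Fin b, IsState (Matrix.single i i (1 : ℂ)) := fun i => by
      rw [← Matrix.diagonal_single]
      refine ⟨Matrix.PosSemidef.diagonal fun j => ?_, by simp⟩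
      by_cases hij : j = i
      · subst hij; simp
      · simp [hij]
    refine ⟨⟨Matrix.posSemidef_sum _ fun i _ => ((hs i).1.kronecker (hsingle i).1).smul
      (Complex.zero_le_real.mpr (hp i)), ?_⟩, ?_⟩
    · rw [Matrix.trace_sum]
      simp only [Matrix.trace_smul, ((hs _).kronecker (hsingle _)).2, smul_eq_mul, mul_one]
      exact_mod_cast hp1
    · intro x y hxy
      rw [Matrix.sum_apply]
      refine Finset.sum_eq_zero fun i _ => ?_
      rw [Matrix.smul_apply, Matrix.kroneckerMap_apply, Matrix.single_apply, if_neg, mul_zero,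
        smul_zero]
      rintro ⟨rfl, h⟩
      exact hxy h
  · rintro ⟨⟨hσ, htr⟩, hd⟩
    have ha : 0 < a := by
      rcases Nat.eq_zero_or_pos a with rfl | h
      · simp [Matrix.trace] at htr
      · exact h
    let B : Fin b → Matrix (Fin a) (Fin a) ℂ := fun i => σ.submatrix (·, i) (·, i)
    have hB : ∀ i, (B i).PosSemidef := fun i => hσ.submatrix _
    have hBt : ∀ i, (((B i).trace.re : ℝ) : ℂ) = (B i).trace := fun i =>
      Complex.ext rfl (by simpa using (Complex.nonneg_iff.mp (hB i).trace_nonneg).2)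
    -- A block of trace zero vanishes, so any state may stand in for it; the maximally mixed one is
    -- chosen.
    refine ⟨fun i => (B i).trace.re, fun i => if (B i).trace = 0 then maxMixed a else
      ((B i).trace)⁻¹ • B i, fun i => (Complex.nonneg_iff.mp (hB i).trace_nonneg).1, ?_, ?_, ?_⟩
    · rw [← Complex.re_sum]
      have : ∑ i, (B i).trace = σ.trace := by
        simp only [Matrix.trace, Matrix.diag_apply, Fintype.sum_prod_type, B,
          Matrix.submatrix_apply]
        exact Finset.sum_comm
      rw [this, htr, Complex.one_re]
    · intro i
      dsimp only
      split_ifs with h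
      · exact isState_maxMixed ha
      · exact ⟨(hB i).smul (by
          rw [← hBt, ← Complex.ofReal_inv, Complex.zero_le_real]
          exact inv_nonneg.mpr (Complex.nonneg_iff.mp (hB i).trace_nonneg).1),
          by rw [Matrix.trace_smul, smul_eq_mul, inv_mul_cancel₀ h]⟩
    · have hs : ∀ i, (((B i).trace.re : ℝ) : ℂ) • (if (B i).trace = 0 then maxMixed a else
          ((B i).trace)⁻¹ • B i) = B i := fun i => by
        rw [hBt]
        split_ifs with h
        · rw [h, zero_smul, eq_comm, ← (hB i).trace_eq_zero_iff, h]
        · rw [smul_smul, mul_inv_cancel₀ h, one_smul]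
      ext ⟨x, i⟩ ⟨y, j⟩
      rw [Matrix.sum_apply]
      simp only [← Matrix.smul_kronecker, hs, Matrix.kroneckerMap_apply, Matrix.single_apply, B,
        Matrix.submatrix_apply]
      by_cases hij : i = j
      · subst hij; simp
      · rw [hd _ _ hij]
        symm
        refine Finset.sum_eq_zero fun k _ => ?_
        rw [if_neg, mul_zero]
        rintro ⟨rfl, h⟩
        exact hij h

lemma IsBobDiag.mapLeft {X : Matrix (Fin a × Fin b) (Fin a × Fin b) ℂ} (hX : IsBobDiag X)
    (E : Op (Fin a) (Fin a')) : IsBobDiag (mapLeft E (Fin b) X) := by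
  intro p q hpq
  change E (Matrix.of fun i j => X (i, p.2) (j, q.2)) p.1 q.1 = 0
  have : (Matrix.of fun i j => X (i, p.2) (j, q.2)) = 0 := by
    ext i j
    exact hX _ _ hpq
  rw [this, map_zero, Matrix.zero_apply]

lemma IsBobDiag.mapRight {X : Matrix (Fin a × Fin b) (Fin a × Fin b) ℂ} (hX : IsBobDiag X)
    {E : Op (Fin b) (Fin b')} (hE : ∀ ρ, IsIncoherentState ρ → (E ρ).IsDiag) :
    IsBobDiag (mapRight (Fin a) E X) := by
  intro p q hpq
  change E (Matrix.of fun i j => X (p.1, i) (q.1, j)) p.2 q.2 = 0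
  have : (Matrix.of fun i j => X (p.1, i) (q.1, j)) =
      ∑ i, X (p.1, i) (q.1, i) • Matrix.single i i (1 : ℂ) := by
    ext i j
    rw [Matrix.sum_apply]
    by_cases hij : i = j
    · subst hij
      simp [Matrix.single_apply]
    · rw [Finset.sum_eq_zero]
      · exact hX _ _ hij
      · intro k _
        rw [Matrix.smul_apply, Matrix.single_apply, if_neg, smul_zero]
        rintro ⟨rfl, h⟩
        exact hij h
  rw [this, map_sum, Matrix.sum_apply]
  refine Finset.sum_eq_zero fun i _ => ?_
  rw [map_smul, Matrix.smul_apply, hE _ _ hpq, smul_zero]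
  rw [← Matrix.diagonal_single]
  refine ⟨⟨Matrix.PosSemidef.diagonal fun j => ?_, by simp⟩, Matrix.isDiag_diagonal _⟩
  by_cases hij : j = i
  · subst hij; simp
  · simp [hij]

lemma IsBobDiag.sum {ι : Type*} {t : Finset ι} {m n : Type*} {X : ι → Matrix (m × n) (m × n) ℂ}
    (hX : ∀ i, IsBobDiag (X i)) : IsBobDiag (∑ i ∈ t, X i) := fun p q hpq => by
  rw [Matrix.sum_apply]
  exact Finset.sum_eq_zero fun i _ => hX i p q hpq

lemma IsLOCC.isBobDiag {P : Prop} {Λ : BiOp a b a' b'} (h : IsLOCC P a' b' a b Λ) :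
    ∀ X, IsBobDiag X → IsBobDiag (Λ X) := by
  induction h with
  | done => exact fun X hX => hX
  | alice d E hE hinc Λ h ih =>
    intro X hX
    rw [LinearMap.sum_apply]
    exact IsBobDiag.sum fun x => ih x _ (hX.mapLeft (E x))
  | bob d E hE Λ h ih =>
    intro X hX
    rw [LinearMap.sum_apply]
    exact IsBobDiag.sum fun x => ih x _ (hX.mapRight fun ρ hρ => (hE.2 ρ hρ x).2)

lemma IsSeparable.isBobDiag {P : Prop} {Λ : BiOp a b a' b'} (h : IsSeparable P Λ)
    (X) (hX : IsBobDiag X) : IsBobDiag (Λ X) := by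
  obtain ⟨k, A, B, -, hB, -, hΛ⟩ := h
  rw [hΛ]
  refine IsBobDiag.sum fun i p q hpq => ?_
  have hB' := isIncoherentKraus_iff.mp (hB i)
  simp only [Matrix.mul_apply, Matrix.conjTranspose_apply, Matrix.kroneckerMap_apply,
    Finset.sum_mul]
  refine Finset.sum_eq_zero fun x _ => Finset.sum_eq_zero fun y _ => ?_
  rw [StarMul.star_mul]
  -- Equal Bob labels: a column of an incoherent Kraus operator has at most one nonzero entry.
  -- Different labels: X vanishes there.
  by_cases hxy : y.2 = x.2
  · rw [hxy]
    linear_combination (A i p.1 y.1 * X y x * star (A i q.1 x.1)) * hB' x.2 p.2 q.2 hpq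
  · rw [hX _ _ hxy]
    ring

lemma isQIPreserving_of_mem (F : FreeClass) {Λ : Channel (Fin a × Fin b) (Fin a' × Fin b')}
    (hΛ : Λ ∈ F.ops a b a' b') : IsQIPreserving Λ.toOp := by
  have key : (∀ X, IsBobDiag X → IsBobDiag (Λ.toOp X)) → IsQIPreserving Λ.toOp := fun h σ hσ => by
    rw [isQuantumIncoherent_iff] at *
    exact ⟨Λ.isState hσ.1, h _ hσ.2⟩
  cases F
  · exact key (IsLOCC.isBobDiag hΛ)
  · exact key (IsLOCC.isBobDiag hΛ)
  · exact key (IsSeparable.isBobDiag hΛ)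
  · exact key (IsSeparable.isBobDiag hΛ)
  · exact hΛ

/-! ### Closure under composition -/

lemma comp_sum_op {l m n ι : Type*} [Fintype ι] (Γ : Op m n) (f : ι → Op l m) :
    Γ ∘ₗ ∑ x, f x = ∑ x, Γ ∘ₗ f x := by
  ext1 X
  simp only [LinearMap.comp_apply, LinearMap.sum_apply, map_sum]

lemma IsLOCC.comp {P : Prop} {Λ : BiOp a b a' b'} {Γ : BiOp a' b' a'' b''}
    (hΛ : IsLOCC P a' b' a b Λ) (hΓ : IsLOCC P a'' b'' a' b' Γ) :
    IsLOCC P a'' b'' a b (Γ ∘ₗ Λ) := by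
  induction hΛ with
  | done => exact hΓ
  | alice d E hE hinc Λ h ih =>
    have := IsLOCC.alice d E hE hinc (fun x => Γ ∘ₗ Λ x) ih
    simpa only [comp_sum_op, LinearMap.comp_assoc] using this
  | bob d E hE Λ h ih =>
    have := IsLOCC.bob d E hE (fun x => Γ ∘ₗ Λ x) ih
    simpa only [comp_sum_op, LinearMap.comp_assoc] using this

lemma IsSeparable.comp {P : Prop} {Λ : BiOp a b a' b'} {Γ : BiOp a' b' a'' b''}
    (hΛ : IsSeparable P Λ) (hΓ : IsSeparable P Γ) : IsSeparable P (Γ ∘ₗ Λ) := by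
  obtain ⟨k, A, B, hA, hB, h1, hΛ⟩ := hΛ
  obtain ⟨k', A', B', hA', hB', h1', hΓ⟩ := hΓ
  refine ⟨k' * k, fun x => A' (finProdFinEquiv.symm x).1 * A (finProdFinEquiv.symm x).2,
    fun x => B' (finProdFinEquiv.symm x).1 * B (finProdFinEquiv.symm x).2,
    fun hP x => (hA' hP _).mul (hA hP _), fun x => (hB' _).mul (hB _), ?_, fun X => ?_⟩
  · rw [Equiv.sum_comp finProdFinEquiv.symm fun x => ((A' x.1 * A x.2)ᴴ * (A' x.1 * A x.2)) ⊗ₖ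
      ((B' x.1 * B x.2)ᴴ * (B' x.1 * B x.2)), Fintype.sum_prod_type, Finset.sum_comm, ← h1]
    refine Finset.sum_congr rfl fun j _ => ?_
    have : ∀ i, ((A' i * A j)ᴴ * (A' i * A j)) ⊗ₖ ((B' i * B j)ᴴ * (B' i * B j)) =
        ((A j)ᴴ ⊗ₖ (B j)ᴴ) * (((A' i)ᴴ * A' i) ⊗ₖ ((B' i)ᴴ * B' i)) * (A j ⊗ₖ B j) := fun i => by
      simp only [← Matrix.mul_kronecker_mul, Matrix.conjTranspose_mul, Matrix.mul_assoc]
    simp only [this]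
    rw [← Matrix.sum_mul, ← Matrix.mul_sum, h1', Matrix.mul_one, Matrix.mul_kronecker_mul]
  · rw [Equiv.sum_comp finProdFinEquiv.symm fun x => ((A' x.1 * A x.2) ⊗ₖ (B' x.1 * B x.2)) * X *
      ((A' x.1 * A x.2) ⊗ₖ (B' x.1 * B x.2))ᴴ, Fintype.sum_prod_type, LinearMap.comp_apply, hΓ, hΛ]
    refine Finset.sum_congr rfl fun i _ => ?_
    rw [Matrix.mul_sum, Matrix.sum_mul]
    refine Finset.sum_congr rfl fun j _ => ?_
    rw [Matrix.mul_kronecker_mul, Matrix.conjTranspose_mul]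
    simp only [Matrix.mul_assoc]

lemma comp_mem_ops (F : FreeClass) {Λ : Channel (Fin a × Fin b) (Fin a' × Fin b')}
    {Γ : Channel (Fin a' × Fin b') (Fin a'' × Fin b'')} (hΛ : Λ ∈ F.ops a b a' b')
    (hΓ : Γ ∈ F.ops a' b' a'' b'') : Γ.comp Λ ∈ F.ops a b a'' b'' := by
  cases F
  · exact IsLOCC.comp hΛ hΓ
  · exact IsLOCC.comp hΛ hΓ
  · exact IsSeparable.comp hΛ hΓ
  · exact IsSeparable.comp hΛ hΓ
  · exact fun σ hσ => hΓ _ (hΛ _ hσ)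

/-! ### Local incoherent operations are free -/

lemma sum_one_kronecker {k : ℕ} {K : Fin k → Matrix (Fin b') (Fin b) ℂ}
    (hK : ∑ s, (K s)ᴴ * K s = 1) :
    ∑ s, ((1 : Matrix (Fin a) (Fin a) ℂ)ᴴ * 1) ⊗ₖ ((K s)ᴴ * K s) = 1 := by
  rw [← Matrix.one_kronecker_one, ← hK]
  ext p q
  simp [Matrix.sum_apply, Finset.mul_sum]

lemma sum_kronecker_one {k : ℕ} {K : Fin k → Matrix (Fin a') (Fin a) ℂ}
    (hK : ∑ s, (K s)ᴴ * K s = 1) :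
    ∑ s, ((K s)ᴴ * K s) ⊗ₖ ((1 : Matrix (Fin b) (Fin b) ℂ)ᴴ * 1) = 1 := by
  rw [← Matrix.one_kronecker_one, ← hK]
  ext p q
  simp [Matrix.sum_apply, Finset.sum_mul]

/-- Incoherent operations by Bob are free. -/
lemma exists_bob_mem_ops (F : FreeClass) (a : ℕ) {k : ℕ} {K : Fin k → Matrix (Fin b') (Fin b) ℂ}
    (hK : ∑ s, (K s)ᴴ * K s = 1) (hinc : ∀ s, IsIncoherentKraus (K s)) :
    ∃ Γ ∈ F.ops a b a b', Γ.toOp = mapRight (Fin a) (krausOp K) := by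
  have hsep : ∀ P, IsSeparable P (mapRight (Fin a) (krausOp K)) := fun P =>
    ⟨k, fun _ => 1, K, fun _ _ => isIncoherentKraus_one, hinc, sum_one_kronecker hK, fun X => by
      rw [mapRight_krausOp, krausOp_apply]⟩
  have hlocc : ∀ P, IsLOCC P a b' a b (mapRight (Fin a) (krausOp K)) := fun P => by
    have := IsLOCC.bob (aliceIncoherent := P) (a := a) _ _ (isMIOInstrument_krausOp hK hinc) _
      fun _ => IsLOCC.done
    simpa using this
  let Γ : Channel (Fin a × Fin b) (Fin a × Fin b') :=
    ⟨mapRight (Fin a) (krausOp K), by rw [mapRight_krausOp]; exact isCP_krausOp _, fun X => by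
      rw [mapRight_krausOp]
      refine trace_krausOp ?_ X
      simpa only [Matrix.conjTranspose_kronecker, ← Matrix.mul_kronecker_mul] using
        sum_one_kronecker hK⟩
  refine ⟨Γ, ?_, rfl⟩
  cases F
  · exact hlocc _
  · exact hlocc _
  · exact hsep _
  · exact hsep _
  · exact isQIPreserving_of_mem .SI (Λ := Γ) (hsep _)

/-- Incoherent operations by Alice are free. -/
lemma exists_alice_mem_ops (F : FreeClass) (b : ℕ) {k : ℕ}
    {K : Fin k → Matrix (Fin a') (Fin a) ℂ}
    (hK : ∑ s, (K s)ᴴ * K s = 1) (hinc : ∀ s, IsIncoherentKraus (K s)) :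
    ∃ Γ ∈ F.ops a b a' b, Γ.toOp = mapLeft (krausOp K) (Fin b) := by
  have hsep : ∀ P, IsSeparable P (mapLeft (krausOp K) (Fin b)) := fun P =>
    ⟨k, K, fun _ => 1, fun _ => hinc, fun _ => isIncoherentKraus_one, sum_kronecker_one hK,
      fun X => by rw [mapLeft_krausOp, krausOp_apply]⟩
  have hlocc : ∀ P, IsLOCC P a' b a b (mapLeft (krausOp K) (Fin b)) := fun P => by
    have hmio := isMIOInstrument_krausOp hK hinc
    have := IsLOCC.alice (aliceIncoherent := P) (b := b) _ _ hmio.1 (fun _ => hmio) _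
      fun _ => IsLOCC.done
    simpa using this
  let Γ : Channel (Fin a × Fin b) (Fin a' × Fin b) :=
    ⟨mapLeft (krausOp K) (Fin b), by rw [mapLeft_krausOp]; exact isCP_krausOp _, fun X => by
      rw [mapLeft_krausOp]
      refine trace_krausOp ?_ X
      simpa only [Matrix.conjTranspose_kronecker, ← Matrix.mul_kronecker_mul] using
        sum_kronecker_one hK⟩
  refine ⟨Γ, ?_, rfl⟩
  cases F
  · exact hlocc _
  · exact hlocc _
  · exact hsep _
  · exact hsep _
  · exact isQIPreserving_of_mem .SI (Λ := Γ) (hsep _)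

/-- Discarding Alice's system is free. -/
lemma exists_discard_mem_ops (F : FreeClass) {Λ : Channel (Fin a × Fin b) (Fin a' × Fin b')}
    (hΛ : Λ ∈ F.ops a b a' b') : ∃ Γ ∈ F.ops a b 1 b',
      ∀ X, traceLeft (Γ.toOp X) = traceLeft (Λ.toOp X) := by
  obtain ⟨T, hT, hTop⟩ := exists_alice_mem_ops F b' (sum_traceKraus a')
    (isIncoherentKraus_traceKraus a')
  refine ⟨T.comp Λ, comp_mem_ops F hΛ hT, fun X => ?_⟩
  ext p q
  change ∑ i, T.toOp (Λ.toOp X) (i, p) (i, q) = _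
  rw [hTop, Fin.sum_univ_one]
  change krausOp (traceKraus a') _ 0 0 = _
  rw [krausOp_traceKraus]
  rfl

/-- There is a free operation with one-dimensional outputs. -/
lemma exists_mem_ops_one (F : FreeClass) (a b : ℕ) : ∃ Λ, Λ ∈ F.ops a b 1 1 := by
  obtain ⟨T, hT, -⟩ := exists_alice_mem_ops F b (sum_traceKraus a)
    (isIncoherentKraus_traceKraus a)
  obtain ⟨S, hS, -⟩ := exists_bob_mem_ops F 1 (sum_traceKraus b)
    (isIncoherentKraus_traceKraus b)
  exact ⟨_, comp_mem_ops F hT hS⟩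

/-- The Kraus operators of a hash function and a factor of a kernel for it. -/
def hashKraus {c l k : ℕ} (f : Fin c → Fin l) (D : Matrix (Fin k) (Fin c) ℂ) (s : Fin k) :
    Matrix (Fin l) (Fin c) ℂ :=
  Matrix.of fun k i => if f i = k then star (D s i) else 0

/-- Bob's operation that belongs to a hash kernel. -/
lemma exists_hash_mem_ops (F : FreeClass) {c l : ℕ} (f : Fin c → Fin l)
    {H : Matrix (Fin c) (Fin c) ℂ} (hH : H ∈ hashKernels f) : ∃ Γ ∈ F.ops 1 c 1 l,
      ∀ X, ∑ i, ∑ j, traceLeft (Γ.toOp X) i j = ∑ i, ∑ j, H i j * traceLeft X i j := by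
  obtain ⟨hH, hd⟩ := hH
  obtain ⟨D, rfl⟩ := CStarAlgebra.nonneg_iff_eq_star_mul_self.mp hH.nonneg
  rw [Matrix.star_eq_conjTranspose] at *
  have hK : ∑ s, (hashKraus f D s)ᴴ * hashKraus f D s = 1 := by
    ext i j
    simp only [Matrix.sum_apply, Matrix.mul_apply, Matrix.conjTranspose_apply, hashKraus,
      Matrix.of_apply, apply_ite star, star_star, star_zero, ite_mul, zero_mul,
      Finset.sum_ite_eq, Finset.mem_univ, if_true, mul_ite, mul_zero]
    -- Only pairs in a common fibre contribute; there the sum is the conjugate of H_ij, an entry of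
    -- the identity.
    by_cases hij : f j = f i
    · have h := congrArg star (hd i j hij.symm)
      rw [Matrix.mul_apply, star_sum] at h
      simp only [hij, if_true]
      have h1 : star ((1 : Matrix (Fin c) (Fin c) ℂ) i j) = (1 : Matrix (Fin c) (Fin c) ℂ) i j := by
        by_cases h : i = j <;> simp [Matrix.one_apply, h]
      rw [← h1, ← h]
      exact Finset.sum_congr rfl fun s _ => by simp [mul_comm]
    · have h1 : i ≠ j := fun h => hij (by rw [h])
      have h2 : ¬f i = f j := fun h => hij h.symm
      simp [h1, h2]
  have hinc : ∀ s, IsIncoherentKraus (hashKraus f D s) := fun s => by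
    rw [isIncoherentKraus_iff]
    intro j i i' hi
    by_cases h : f j = i
    · subst h; simp [hashKraus, hi]
    · simp [hashKraus, h]
  obtain ⟨Γ, hΓ, hop⟩ := exists_bob_mem_ops F 1 hK hinc
  refine ⟨Γ, hΓ, fun X => ?_⟩
  have h1 : ∀ i j, traceLeft (Γ.toOp X) i j = krausOp (hashKraus f D) (traceLeft X) i j := by
    intro i j
    have : traceLeft X = Matrix.of fun i j => X (0, i) (0, j) := by
      ext i j
      simp [traceLeft]
    rw [this, hop]
    simp only [traceLeft, Matrix.of_apply, Fin.sum_univ_one]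
    rfl
  have h2 : ∀ s, ∑ k, ∑ k', ∑ i, ∑ j, hashKraus f D s k i * traceLeft X i j *
      star (hashKraus f D s k' j) = ∑ i, ∑ j, star (D s i) * D s j * traceLeft X i j := by
    intro s
    have : ∀ k k', ∑ i, ∑ j, hashKraus f D s k i * traceLeft X i j *
        star (hashKraus f D s k' j) = ∑ i, ∑ j, if f i = k then (if f j = k' then
          star (D s i) * D s j * traceLeft X i j else 0) else 0 := fun k k' =>
      Finset.sum_congr rfl fun i _ => Finset.sum_congr rfl fun j _ => by
        simp only [hashKraus, Matrix.of_apply]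
        split_ifs <;> simp
        ring
    simp only [this]
    rw [Finset.sum_congr rfl fun k _ => Finset.sum_comm, Finset.sum_comm]
    refine Finset.sum_congr rfl fun i _ => ?_
    rw [Finset.sum_congr rfl fun k _ => Finset.sum_comm, Finset.sum_comm]
    refine Finset.sum_congr rfl fun j _ => ?_
    simp
  simp only [h1, krausOp_entry]
  rw [Finset.sum_congr rfl fun k _ => Finset.sum_comm, Finset.sum_comm]
  simp only [h2, Matrix.mul_apply, Matrix.conjTranspose_apply, Finset.sum_mul]
  rw [Finset.sum_comm]
  exact Finset.sum_congr rfl fun i _ => Finset.sum_comm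

end Free

/-! ### Distillation and extraction rates -/

section Rates

variable {a b r : ℕ}

lemma traceLeft_posSemidef {m n : Type*} [Fintype m] [Fintype n] {X : Matrix (m × n) (m × n) ℂ}
    (hX : X.PosSemidef) : (traceLeft X).PosSemidef := by
  have : traceLeft X = ∑ i, X.submatrix (fun p => (i, p)) (fun p => (i, p)) := by
    ext p q
    simp [traceLeft, Matrix.sum_apply]
  rw [this]
  exact Matrix.posSemidef_sum _ fun i _ => hX.submatrix _

lemma trace_traceLeft {m n : Type*} [Fintype m] [Fintype n] (X : Matrix (m × n) (m × n) ℂ) :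
    (traceLeft X).trace = X.trace := by
  simp only [Matrix.trace, Matrix.diag_apply, traceLeft, Matrix.of_apply, Fintype.sum_prod_type]
  exact Finset.sum_comm

lemma IsState.traceLeft {m n : Type*} [Fintype m] [Fintype n] {X : Matrix (m × n) (m × n) ℂ}
    (hX : IsState X) : IsState (traceLeft X) :=
  ⟨traceLeft_posSemidef hX.1, (trace_traceLeft X).trans hX.2⟩

lemma IsState.nonempty {m : Type*} [Fintype m] {ρ : Matrix m m ℂ} (hρ : IsState ρ) :
    Nonempty m := by
  by_contra h
  rw [not_nonempty_iff] at h
  simpa [Matrix.trace] using hρ.2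

lemma IsState.pos {d : ℕ} {ρ : Matrix (Fin d) (Fin d) ℂ} (hρ : IsState ρ) : 0 < d :=
  Fin.pos_iff_nonempty.mpr hρ.nonempty

lemma IsState.one_sub_posSemidef {m : Type*} [Fintype m] [DecidableEq m] {ρ : Matrix m m ℂ}
    (hρ : IsState ρ) : (1 - ρ).PosSemidef := by
  have hH := hρ.1.isHermitian
  have h : ρ ≤ algebraMap ℝ _ 1 := by
    refine le_algebraMap_of_spectrum_le (fun x hx => ?_) hH.isSelfAdjoint
    rw [hH.spectrum_real_eq_range_eigenvalues] at hx
    obtain ⟨i, rfl⟩ := hx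
    have h1 : ∑ i, hH.eigenvalues i = 1 := by
      have := hH.trace_eq_sum_eigenvalues
      rw [hρ.2] at this
      simpa using (congrArg Complex.re this).symm
    rw [← h1]
    exact Finset.single_le_sum (fun j _ => hρ.1.eigenvalues_nonneg j) (Finset.mem_univ i)
  rwa [map_one, Matrix.le_iff] at h

/-- Tracing out E undoes the dilation and tracing out R the purification. Hence the choices of ψ and
U do not matter. -/
lemma marginal_tauVec {c : ℕ} {Λ : Channel (Fin a × Fin b) (Fin 1 × Fin c)} (S : Stinespring Λ)
    {ψ : Fin r × (Fin a × Fin b) → ℂ} {ρ : Matrix (Fin a × Fin b) (Fin a × Fin b) ℂ}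
    (hψ : IsPurification ψ ρ) : marginal (tauVec S ψ) = traceLeft (Λ.toOp ρ) := by
  ext i j
  rw [S.dilates, ← hψ]
  simp only [marginal, tauVec, traceLeft, traceRight, Matrix.of_apply, Fin.sum_univ_one,
    Fintype.sum_prod_type (α₁ := Fin S.e), Matrix.mul_apply, Matrix.conjTranspose_apply, proj,
    Matrix.vecMulVec_apply, Pi.star_apply]
  refine Finset.sum_congr rfl fun e _ => ?_
  simp only [star_sum, Finset.mul_sum, Finset.sum_mul]
  rw [Finset.sum_comm, Finset.sum_congr rfl fun p _ => Finset.sum_comm]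
  refine Finset.sum_congr rfl fun q _ => Finset.sum_congr rfl fun p _ =>
    Finset.sum_congr rfl fun x _ => ?_
  rw [StarMul.star_mul]
  ring

lemma exists_unit_vector {s : Type*} [Fintype s] [DecidableEq s] [Nonempty s] (v : s → ℂ) :
    ∃ w : s → ℂ, ∑ x, ‖w x‖ ^ 2 = 1 ∧ ‖∑ x, star (w x) * v x‖ = √(∑ x, ‖v x‖ ^ 2) := by
  set n := √(∑ x, ‖v x‖ ^ 2) with hn
  have hn2 : ∑ x, ‖v x‖ ^ 2 = n ^ 2 := (Real.sq_sqrt (by positivity)).symm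
  by_cases h : n = 0
  · obtain ⟨x₀⟩ := ‹Nonempty s›
    refine ⟨Pi.single x₀ 1, ?_, ?_⟩
    · rw [Finset.sum_eq_single x₀ (fun x _ hx => by simp [hx]) (by simp)]
      simp
    · rw [h, zero_pow two_ne_zero, Finset.sum_eq_zero_iff_of_nonneg (fun _ _ => by positivity)]
        at hn2
      have : ∀ x, v x = 0 := fun x => by simpa using hn2 x (Finset.mem_univ x)
      simp [this, h]
  · refine ⟨fun x => v x / n, ?_, ?_⟩
    · simp only [norm_div, div_pow, ← Finset.sum_div, hn2, Complex.norm_real, Real.norm_eq_abs,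
        sq_abs]
      exact div_self (pow_ne_zero 2 h)
    · have : ∑ x, star (v x / (n : ℂ)) * v x = ((∑ x, ‖v x‖ ^ 2 : ℝ) : ℂ) / n := by
        push_cast
        rw [Finset.sum_div]
        refine Finset.sum_congr rfl fun x _ => ?_
        rw [← Complex.conj_mul', RCLike.star_def, map_div₀, Complex.conj_ofReal]
        ring
      rw [this, hn2, ← Complex.ofReal_div, Complex.norm_real, Real.norm_eq_abs, sq,
        mul_div_cancel_right₀ n h, abs_of_nonneg (Real.sqrt_nonneg _)]

variable {ρ : Matrix (Fin a × Fin b) (Fin a × Fin b) ℂ} {ψ : Fin r × (Fin a × Fin b) → ℂ}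

/-- Guarantees that ER has a state, so that the infimum in `dSec` is not over an empty family. -/
lemma nonempty_of_tauVec (hρ : IsState ρ) (hψ : IsPurification ψ ρ) {c : ℕ}
    {Λ : Channel (Fin a × Fin b) (Fin 1 × Fin c)} (S : Stinespring Λ) :
    Nonempty (Fin S.e × Fin r) := by
  by_contra h
  rw [not_nonempty_iff] at h
  have h1 := ((Λ.isState hρ).traceLeft).2
  rw [← marginal_tauVec S hψ] at h1
  simp [marginal, Matrix.trace] at h1

/-- Dephasing the output of a distillation protocol extracts randomness. -/
lemma dSec_finalState_id_le (hρ : IsState ρ) (hψ : IsPurification ψ ρ) {d : ℕ}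
    {Λ : Channel (Fin a × Fin b) (Fin 1 × Fin d)} (S : Stinespring Λ) :
    dSec (finalState S ψ id) ≤ purifiedDistance (traceLeft (Λ.toOp ρ)) (maxCoherent d) := by
  have hX := (Λ.isState hρ).traceLeft
  have hd := hX.pos
  have := nonempty_of_tauVec hρ hψ S
  set t := tauVec S ψ with ht
  -- Aligned with ∑ t_i, so that its overlap with this sum is the full norm.
  obtain ⟨w, hw, hwt⟩ := exists_unit_vector fun x => ∑ i, t (i, x)
  refine (ciInf_le ⟨0, ?_⟩ ⟨proj w, isState_proj hw⟩).trans (purifiedDistance_anti ?_)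
  · rintro _ ⟨σ, rfl⟩
    exact Real.sqrt_nonneg _
  rw [fidelity_maxCoherent hd hX.1, finalState, fidelity_dephase_maxMixed_proj hd _ hw,
    ← marginal_tauVec S hψ, ← ht]
  have h1 : (∑ i, ∑ j, marginal t i j).re = ∑ x, ‖∑ i, t (i, x)‖ ^ 2 := by
    have : ((∑ x, ‖∑ i, t (i, x)‖ ^ 2 : ℝ) : ℂ) = ∑ i, ∑ j, marginal t i j := by
      push_cast
      simp only [← Complex.mul_conj', map_sum, Finset.sum_mul_sum, marginal, Matrix.of_apply,
        RCLike.star_def]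
      rw [Finset.sum_comm]
      exact Finset.sum_congr rfl fun i _ => Finset.sum_comm
    rw [← this, Complex.ofReal_re]
  rw [h1, Real.sqrt_div (by positivity), ← hwt]
  gcongr
  have h2 : ∑ x, star (w x) * ∑ i, t (i, x) = ∑ i, ∑ x, star (w x) * t (i, x) := by
    simp only [Finset.mul_sum]
    exact Finset.sum_comm
  rw [h2]
  exact norm_sum_le _ _

/-- Every extraction protocol gives rise to a distillation protocol that is at least as good. -/
lemma exists_purifiedDistance_le_dSec (F : FreeClass) (hρ : IsState ρ) (hψ : IsPurification ψ ρ)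
    {c l : ℕ} {Λ : Channel (Fin a × Fin b) (Fin 1 × Fin c)} (hΛ : Λ ∈ F.ops a b 1 c)
    (S : Stinespring Λ) (f : Fin c → Fin l) (hl : 0 < l) :
    ∃ Γ ∈ F.ops a b 1 l, purifiedDistance (traceLeft (Γ.toOp ρ)) (maxCoherent l) ≤
      dSec (finalState S ψ f) := by
  have := nonempty_of_tauVec hρ hψ S
  set X := traceLeft (Λ.toOp ρ) with hX
  have hcont : Continuous fun H : Matrix (Fin c) (Fin c) ℂ => (∑ i, ∑ j, H i j * X i j).re := by
    fun_prop
  -- The kernel is fixed before σ: one protocol has to beat every σ in the infimum.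
  obtain ⟨H, hH, hmax⟩ := (isCompact_hashKernels f).exists_isMaxOn
    ⟨1, Matrix.PosSemidef.one, fun _ _ _ => rfl⟩ hcont.continuousOn
  obtain ⟨N, hN, hNX⟩ := exists_hash_mem_ops F f hH
  refine ⟨N.comp Λ, comp_mem_ops F hΛ hN, ?_⟩
  have hst := ((N.comp Λ).isState hρ).traceLeft
  obtain ⟨x₀⟩ := this
  have hσ₀ : IsState (proj (Pi.single x₀ 1 : Fin S.e × Fin r → ℂ)) := by
    apply isState_proj
    rw [Finset.sum_eq_single x₀ (fun x _ hx => by simp [hx]) (by simp)]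
    simp
  have : Nonempty {σ : Matrix (Fin S.e × Fin r) (Fin S.e × Fin r) ℂ // IsState σ} := ⟨_, hσ₀⟩
  refine le_ciInf fun σ => purifiedDistance_anti ?_
  rw [fidelity_maxCoherent hl hst.1]
  obtain ⟨H', hH', hle⟩ := exists_hashKernel_fidelity_sq_le hl f (tauVec S ψ) σ.2
  refine Real.le_sqrt_of_sq_le (hle.trans ?_)
  rw [marginal_tauVec S hψ]
  change _ ≤ (∑ i, ∑ j, traceLeft (N.toOp (Λ.toOp ρ)) i j).re / l
  rw [hNX]
  exact div_le_div_of_nonneg_right (hmax hH') l.cast_nonneg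

/-- The overlap of the output of a free operation with the maximally coherent state is bounded. -/
lemma re_sum_traceLeft_le (F : FreeClass) (hρ : IsState ρ) {a' b' : ℕ}
    {Λ : Channel (Fin a × Fin b) (Fin a' × Fin b')} (hΛ : Λ ∈ F.ops a b a' b') :
    (∑ i, ∑ j, traceLeft (Λ.toOp ρ) i j).re ≤ a * b := by
  have hab : ((a * b : ℕ) : ℂ) ≠ 0 := by
    obtain ⟨i, j⟩ := hρ.nonempty
    have := (Fin.pos i).ne'
    have := (Fin.pos j).ne'
    simp [*]
  set z : ℂ := ((a * b : ℕ) : ℂ)⁻¹ with hz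
  -- QIP speaks of states only; normalizing the identity makes it applicable, and linearity then
  -- shows that Λ(1) is diagonal for Bob.
  have hmix : IsQuantumIncoherent (z • (1 : Matrix (Fin a × Fin b) (Fin a × Fin b) ℂ)) := by
    rw [isQuantumIncoherent_iff]
    refine ⟨⟨Matrix.PosSemidef.one.smul ?_, ?_⟩, fun p q hpq => ?_⟩
    · rw [hz, ← Complex.ofReal_natCast, ← Complex.ofReal_inv, Complex.zero_le_real]
      positivity
    · rw [Matrix.trace_smul, Matrix.trace_one, Fintype.card_prod, Fintype.card_fin,
        Fintype.card_fin, smul_eq_mul, hz, inv_mul_cancel₀ hab]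
    · rw [Matrix.smul_apply, Matrix.one_apply_ne (fun h => hpq (by rw [h])), smul_zero]
  have hdiag : ∀ i j, i ≠ j → traceLeft (Λ.toOp 1) i j = 0 := by
    intro i j hij
    have h := (isQuantumIncoherent_iff.mp (isQIPreserving_of_mem F hΛ _ hmix)).2
    change ∑ x, Λ.toOp 1 (x, i) (x, j) = 0
    refine Finset.sum_eq_zero fun x _ => ?_
    have h' := h (x, i) (x, j) hij
    rw [map_smul, Matrix.smul_apply, smul_eq_mul] at h'
    exact (mul_eq_zero.mp h').resolve_left (inv_ne_zero hab)
  have hone : ∑ i, ∑ j, traceLeft (Λ.toOp 1) i j = ((a * b : ℕ) : ℂ) := by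
    have h1 : ∀ i, ∑ j, traceLeft (Λ.toOp 1) i j = traceLeft (Λ.toOp 1) i i := fun i =>
      Finset.sum_eq_single i (fun j _ hj => hdiag i j hj.symm) (by simp)
    simp only [h1]
    change (traceLeft (Λ.toOp 1)).trace = _
    rw [trace_traceLeft, Λ.tp, Matrix.trace_one, Fintype.card_prod, Fintype.card_fin,
      Fintype.card_fin]
  -- Positivity of Λ(1 - ρ), tested on the all-ones vector, compares ρ with the identity.
  have hnn := (Complex.nonneg_iff.mp (sum_sum_nonneg (traceLeft_posSemidef
    (Λ.posSemidef hρ.one_sub_posSemidef)))).1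
  have hsub : ∑ i, ∑ j, traceLeft (Λ.toOp (1 - ρ)) i j =
      ∑ i, ∑ j, traceLeft (Λ.toOp 1) i j - ∑ i, ∑ j, traceLeft (Λ.toOp ρ) i j := by
    simp only [map_sub, traceLeft, Matrix.of_apply, Matrix.sub_apply, Finset.sum_sub_distrib]
  rw [hsub, hone, Complex.sub_re, Complex.natCast_re] at hnn
  push_cast at hnn
  linarith

lemma distillationRates_eq_extractionRates (F : FreeClass) (hρ : IsState ρ)
    (hψ : IsPurification ψ ρ)
    (V : ∀ (c : ℕ) (Λ : Channel (Fin a × Fin b) (Fin 1 × Fin c)), Stinespring Λ) (ε : ℝ) :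
    distillationRates F ε ρ = extractionRates F ε ψ V := by
  ext x
  constructor
  · rintro ⟨a', b', Λ, hΛ, hP, rfl⟩
    obtain ⟨Γ, hΓ, hop⟩ := exists_discard_mem_ops F hΛ
    refine ⟨b', Γ, hΓ, b', id, ?_, rfl⟩
    rw [← hop] at hP
    exact (dSec_finalState_id_le hρ hψ (V b' Γ)).trans hP
  · rintro ⟨c, Λ, hΛ, l, f, hP, rfl⟩
    -- A state on C forces c > 0, and then f forces l > 0.
    obtain ⟨i⟩ := ((Λ.isState hρ).traceLeft).nonempty
    obtain ⟨Γ, hΓ, hle⟩ := exists_purifiedDistance_le_dSec F hρ hψ hΛ (V c Λ) f (Fin.pos (f i))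
    exact ⟨1, l, Γ, hΓ, hle.trans hP, rfl⟩

/-- Discarding everything yields the one-dimensional state Ψ_1 exactly, at rate zero. -/
lemma distillationRates_nonempty (F : FreeClass) (hρ : IsState ρ) {ε : ℝ} (hε : 0 ≤ ε) :
    (distillationRates F ε ρ).Nonempty := by
  obtain ⟨Λ, hΛ⟩ := exists_mem_ops_one F a b
  refine ⟨_, 1, 1, Λ, hΛ, ?_, rfl⟩
  have h := (Λ.isState hρ).traceLeft
  have h1 : ∑ i, ∑ j, traceLeft (Λ.toOp ρ) i j = 1 := by
    rw [← h.2]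
    simp [Matrix.trace]
  rw [purifiedDistance, fidelity_maxCoherent one_pos h.1, h1]
  simpa using hε

lemma distillationRates_finite (F : FreeClass) (hρ : IsState ρ) {ε : ℝ} (hε0 : 0 ≤ ε)
    (hε : ε < 1) : (distillationRates F ε ρ).Finite := by
  -- From 1 - ε² ≤ F² ≤ ab/b' one gets b' ≤ ab/(1 - ε²).
  refine ((Finset.range (⌊a * b / (1 - ε ^ 2)⌋₊ + 1)).finite_toSet.image
    fun n : ℕ => Real.logb 2 n).subset ?_
  rintro _ ⟨a', b', Λ, hΛ, hP, rfl⟩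
  refine ⟨b', ?_, rfl⟩
  have h := (Λ.isState hρ).traceLeft
  have hb : (0 : ℝ) < b' := Nat.cast_pos.mpr h.pos
  have hε2 : 0 < 1 - ε ^ 2 := by nlinarith
  rw [purifiedDistance, fidelity_maxCoherent h.pos h.1, Real.sqrt_le_left hε0, Real.sq_sqrt
    (div_nonneg (Complex.nonneg_iff.mp (sum_sum_nonneg h.1)).1 hb.le)] at hP
  have h2 := re_sum_traceLeft_le F hρ hΛ
  have h3 : 1 - ε ^ 2 ≤ a * b / b' := by
    have : (∑ i, ∑ j, traceLeft (Λ.toOp ρ) i j).re / b' ≤ a * b / b' := by gcongr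
    linarith
  rw [Finset.mem_coe, Finset.mem_range, Nat.lt_succ_iff]
  refine Nat.le_floor ?_
  rw [le_div_iff₀ hb] at h3
  rw [le_div_iff₀ hε2]
  linarith

end Rates

end AssistedCoherence

theorem mainTheorem8 (F : FreeClass) {a b r : ℕ}
    (ρ : Matrix (Fin a × Fin b) (Fin a × Fin b) ℂ) (hρ : IsState ρ)
    (ψ : Fin r × (Fin a × Fin b) → ℂ) (hψ : IsPurification ψ ρ)
    (V : ∀ (c : ℕ) (Λ : Channel (Fin a × Fin b) (Fin 1 × Fin c)), Stinespring Λ)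
    (ε : ℝ) (hε0 : 0 ≤ ε) (hε1 : ε ≤ 1) :
    distillableCoherence F ε ρ = extractableRandomness F ε ψ V ∧
    (ε < 1 → ∃ x : ℝ, IsGreatest (distillationRates F ε ρ) x ∧
      IsGreatest (extractionRates F ε ψ V) x) := by
  have h := distillationRates_eq_extractionRates F hρ hψ V ε
  refine ⟨by rw [distillableCoherence, extractableRandomness, h], fun hε => ?_⟩
  obtain ⟨x, hx, hmax⟩ := Set.exists_max_image _ id (distillationRates_finite F hρ hε0 hε)
    (distillationRates_nonempty F hρ hε0)
  exact ⟨x, ⟨hx, hmax⟩, h ▸ ⟨hx, hmax⟩⟩
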